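/- Let $X$ be a countable set with a measure $m$ on all its subsets such that $0<m(x):=m(\{x\})<\infty$ for all $x\in X$, and let $(b,c)$ be a graph over $(X,m)$: $b\colon X\times X\to[0,\infty)$ is symmetric, vanishes on the diagonal, $\sum_y b(x,y)<\infty$ for all $x$, and $c\colon X\to[0,\infty)$. Put $$\mathcal Q(f,g)=\tfrac12\sum_{x,y}b(x,y)(f(x)-f(y))(g(x)-g(y))+\sum_x c(x)f(x)g(x),\qquad \mathcal Q(f)=\mathcal Q(f,f)\in[0,\infty],$$ $$\mathcal Lf(x)=\tfrac1{m(x)}\sum_y b(x,y)(f(x)-f(y))+\tfrac{c(x)}{m(x)}f(x).$$ Let $Q^{(N)}$ be the restriction of $\mathcal Q$ to $D(Q^{(N)})=\{f\in\ell^2(X,m)\mid\mathcal Q(f)<\infty\}$, and $Q^{(D)}$ its restriction to the closure $D(Q^{(D)})$ of the finitely supported functions with respect to the form norm $(\mathcal Q(f)+\|f\|^2)^{1/2}$. Let $L^{(N)}$, $L^{(D)}$ be the associated self-adjoint operators on $\ell^2(X,m)$. Let $\hat X$ be the compact Hausdorff space, unique up to homeomorphism, that contains $X$ as a dense subset consisting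 of open points and to which all bounded $f\in D(Q^{(N)})$ extend continuously, the extensions separating the points of $\hat X$. Every $f\in D(Q^{(N)})$ extends uniquely to a continuous function $\hat X\to[-\infty,\infty]$, again denoted by $f$. The $1$-harmonic boundary is $$\partial X=\{z\in\hat X\setminus X\mid f(z)=0\text{ for all bounded }f\in D(Q^{(D)})\}.$$ A $1$-harmonic measure is a Radon measure $\mu=\mu_o$ on $\partial X$, for some $o\in X$, with $\mu(\partial X)\le1$ and $h(o)=\int_{\partial X}f\,d\mu$ whenever $f\in D(Q^{(N)})$ is bounded and $h\in D(Q^{(N)})$ satisfies $\mathcal Lh+h=0$ on $X$ and $h=f$ on $\partial X$; if $1\notin D(Q^{(N)})$, it is also required that $\mu(\{\infty\})=0$ for the point $\infty\in\partial X$ at which all bounded functions in $D(Q^{(N)})$ vanish. Fix a $1$-harmonic measure $\mu$. For $f\in D(Q^{(N)})$ with $\mathcal Lf\in\ell^2(X,m)$ let $\partial_nf(g)=Q^{(N)}(f,g)-\langle\mathcal Lf,g\rangle$ for $g\in D(Q^{(N)})$. If there is $\varphi\in L^2(\partial X,\mu)$ with $\int_{\partial X}\varphi g\,d\mu=\partial_nf(g)$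 for all $g\in D(Q^{(N)})$, write $f\in D(\partial_{n,\mu})$ and $\partial_{n,\mu}f=\varphi$. For a measurable $\beta\colon\partial X\to[0,\infty]$ let $F_\beta$ be the support of the measure $1_{\{\beta=\infty\}}\mu$, and define (with $\infty\cdot0=0$) $$D(Q^\beta)=\Big\{f\in D(Q^{(N)})\,\Big|\,\int_{\partial X}|f|^2\beta\,d\mu<\infty\Big\},\qquad Q^\beta(f)=Q^{(N)}(f)+\int_{\partial X}|f|^2\beta\,d\mu.$$ Let $L^\beta$ be the restriction of $\mathcal L$ to the set $D(L^\beta)$ of all $f\in D(Q^{(N)})$ with $\mathcal Lf\in\ell^2(X,m)$, $\int_{\partial X}|f|^2\beta\,d\mu<\infty$, $f=0$ on $F_\beta$, and $$\partial_nf(g)+\int_{\partial X}fg\,\beta\,d\mu=0\quad\text{for all }g\in D(Q^{(N)})\text{ with }\int_{\partial X}|g|^2\beta\,d\mu<\infty\text{ and }g=0\text{ on }F_\beta.$$ **Theorem.** For every measurable $\beta\colon\partial X\to[0,\infty]$ the form $Q^\beta$ is a Dirichlet form, and $L^\beta$ is the self-adjoint operator of $Q^\beta$. In particular, $Q^{(N)}=Q^0$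 and, if the graph is connected, $Q^{(D)}=Q^\infty$ (the form $Q^\beta$ for $\beta\equiv\infty$). Moreover, $L^{(D)}$ and $L^{(N)}$ are the restrictions of $\mathcal L$ to $$D(L^{(D)})=\{f\in D(Q^{(N)})\mid\mathcal Lf\in\ell^2(X,m),\ f=0\text{ on }\partial X\},$$ $$D(L^{(N)})=\{f\in D(Q^{(N)})\mid\mathcal Lf\in\ell^2(X,m),\ \partial_nf=0\}=\ker\partial_{n,\mu}.$$ -/

import Mathlib

open MeasureTheory Set Filter Topology
open scoped ENNReal

noncomputable section

/-! ## Forms and operators on a Hilbert space -/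

/-- The data of a form on `H`: a domain and a real-valued function of two variables.  The values
`val f g` have a meaning only for `f, g` in the domain; the laws are in `HForm.IsForm`. -/
structure HForm (H : Type*) where
  dom : Set H
  val : H → H → ℝ

namespace HForm

section Hilbert

variable {H : Type*} [NormedAddCommGroup H] [InnerProductSpace ℝ H]

/-- Two forms are equal: same domain, and same values on the domain. -/
def Same (Q Q' : HForm H) : Prop :=
  Q.dom = Q'.dom ∧ ∀ f ∈ Q.dom, ∀ g ∈ Q.dom, Q.val f g = Q'.val f g

/-- `Q` is a symmetric positive form: its domain is a linear subspace, on which `Q` is symmetric,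
bilinear and positive. -/
structure IsForm (Q : HForm H) : Prop where
  zero_mem : (0 : H) ∈ Q.dom
  add_mem : ∀ f ∈ Q.dom, ∀ g ∈ Q.dom, f + g ∈ Q.dom
  smul_mem : ∀ (a : ℝ), ∀ f ∈ Q.dom, a • f ∈ Q.dom
  symm : ∀ f ∈ Q.dom, ∀ g ∈ Q.dom, Q.val f g = Q.val g f
  linear : ∀ f ∈ Q.dom, ∀ g ∈ Q.dom, ∀ h ∈ Q.dom, ∀ α β : ℝ,
    Q.val f (α • g + β • h) = α * Q.val f g + β * Q.val f h
  nonneg : ∀ f ∈ Q.dom, 0 ≤ Q.val f f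

/-- The square of the form norm, `Q₁(f) = Q(f) + ‖f‖²`. -/
def normSq (Q : HForm H) (f : H) : ℝ := Q.val f f + ‖f‖ ^ 2

/-- `Q` is closed: its domain is complete with respect to the form norm. -/
def Closed (Q : HForm H) : Prop :=
  ∀ u : ℕ → H, (∀ n, u n ∈ Q.dom) →
    (∀ ε : ℝ, 0 < ε → ∃ N, ∀ n ≥ N, ∀ k ≥ N, Q.normSq (u n - u k) < ε) →
    ∃ f ∈ Q.dom, Tendsto (fun n => Q.normSq (u n - f)) atTop (𝓝 0)

/-- `L` is the positive self-adjoint operator of the form `Q`: it is densely defined, self-adjoint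
and positive, with `D(L) ⊆ D(Q)` and `Q(f, g) = ⟨f, L g⟩` for `f ∈ D(Q)`, `g ∈ D(L)`. -/
structure IsOperatorOf [CompleteSpace H] (L : H →ₗ.[ℝ] H) (Q : HForm H) : Prop where
  dense : Dense (L.domain : Set H)
  selfAdjoint : IsSelfAdjoint L
  nonneg : ∀ g : L.domain, 0 ≤ inner ℝ (L g) (g : H)
  domain_subset : (L.domain : Set H) ⊆ Q.dom
  val_eq : ∀ f ∈ Q.dom, ∀ g : L.domain, Q.val f g = inner ℝ f (L g)

end Hilbert

/-- `Q` is a Dirichlet form on `L²(α, m)`: a closed, densely defined form that is compatible with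
all normal contractions. -/
structure IsDirichletForm {α : Type*} [MeasurableSpace α] {m : Measure α}
    (Q : HForm (Lp ℝ 2 m)) : Prop where
  isForm : Q.IsForm
  closed : Q.Closed
  dense : Dense Q.dom
  markov : ∀ (C : ℝ → ℝ) (hC : LipschitzWith 1 C) (hC0 : C 0 = 0), ∀ f ∈ Q.dom,
    hC.compLp hC0 f ∈ Q.dom ∧ Q.val (hC.compLp hC0 f) (hC.compLp hC0 f) ≤ Q.val f f

end HForm

/-! ## Graphs, energy and the formal Laplacian -/

/-- A (weighted) graph `(b, c)` over `X`. -/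
structure WGraph (X : Type*) where
  b : X → X → ℝ
  c : X → ℝ
  b_nonneg : ∀ x y, 0 ≤ b x y
  b_symm : ∀ x y, b x y = b y x
  b_self : ∀ x, b x x = 0
  b_summable : ∀ x, Summable (b x)
  c_nonneg : ∀ x, 0 ≤ c x

namespace WGraph

variable {X : Type*} (G : WGraph X)

/-- Any two vertices are joined by a finite path of edges. -/
def Connected : Prop := ∀ x y, Relation.ReflTransGen (fun u v => 0 < G.b u v) x y

/-- The energy `𝒬(f) ∈ [0, ∞]`. -/
def energy (f : X → ℝ) : ℝ≥0∞ :=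
  2⁻¹ * (∑' x, ∑' y, ENNReal.ofReal (G.b x y * (f x - f y) ^ 2))
    + ∑' x, ENNReal.ofReal (G.c x * f x ^ 2)

/-- The energy `𝒬(f, g)` for `f, g` of finite energy (both series then converge absolutely). -/
def energyBilin (f g : X → ℝ) : ℝ :=
  1 / 2 * (∑' p : X × X, G.b p.1 p.2 * (f p.1 - f p.2) * (g p.1 - g p.2))
    + ∑' x, G.c x * f x * g x

theorem energy_single_lt_top [DecidableEq X] (x : X) : G.energy (Pi.single x 1) < ∞ := by
  have hs : ∑' y, ENNReal.ofReal (G.b x y) < ∞ :=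
    (G.b_summable x).tsum_ofReal_lt_top
  refine ENNReal.add_lt_top.2 ⟨ENNReal.mul_lt_top (by simp) ?_, ?_⟩
  · have hle : ∀ u v, ENNReal.ofReal (G.b u v *
        ((Pi.single x 1 : X → ℝ) u - (Pi.single x 1 : X → ℝ) v) ^ 2) ≤
        (if u = x then ENNReal.ofReal (G.b x v) else 0) +
          (if v = x then ENNReal.ofReal (G.b x u) else 0) := by
      intro u v
      by_cases hu : u = x <;> by_cases hv : v = x
      · subst hu; subst hv; simp
      · subst hu; simp [hv]
      · subst hv; simp [hu, G.b_symm u v]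
      · simp [hu, hv]
    refine (ENNReal.tsum_le_tsum fun u => ENNReal.tsum_le_tsum fun v => hle u v).trans_lt ?_
    simp only [ENNReal.tsum_add]
    refine ENNReal.add_lt_top.2 ⟨?_, ?_⟩
    · rw [tsum_eq_single x (by intro u hu; simp [hu])]
      simpa using hs
    · simpa using hs
  · rw [tsum_eq_single x (by intro u hu; simp [hu])]
    simp

variable [MeasurableSpace X] (m : Measure X)

/-- The formal Laplacian (the series converges for `f` of finite energy). -/
def lap (f : X → ℝ) (x : X) : ℝ :=
  1 / m.real {x} * (∑' y, G.b x y * (f x - f y)) + G.c x / m.real {x} * f x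

/-- The Neumann form domain: functions in `ℓ²(X, m)` of finite energy. -/
def neumannDom : Set (X → ℝ) := {f | MemLp f 2 m ∧ G.energy f < ∞}

/-- The Dirichlet form domain: the closure of the finitely supported functions in the Neumann form
domain with respect to the form norm. -/
def dirichletDom : Set (X → ℝ) :=
  {f | f ∈ G.neumannDom m ∧ ∀ ε : ℝ≥0∞, 0 < ε → ∃ φ : X → ℝ, φ.support.Finite ∧
    G.energy (f - φ) + eLpNorm (f - φ) 2 m ^ 2 < ε}

/-- The form `Q^(N)` on `ℓ²(X, m)`. -/
def neumannForm : HForm (Lp ℝ 2 m) where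
  dom := {f | (f : X → ℝ) ∈ G.neumannDom m}
  val f g := G.energyBilin f g

/-- The form `Q^(D)` on `ℓ²(X, m)`. -/
def dirichletForm : HForm (Lp ℝ 2 m) where
  dom := {f | (f : X → ℝ) ∈ G.dirichletDom m}
  val f g := G.energyBilin f g

/-- The operator `L` on `ℓ²(X, m)` is the restriction of the formal Laplacian to `D`. -/
def IsLapRestriction (L : Lp ℝ 2 m →ₗ.[ℝ] Lp ℝ 2 m) (D : Set (X → ℝ)) : Prop :=
  (∀ f : Lp ℝ 2 m, f ∈ L.domain ↔ (f : X → ℝ) ∈ D) ∧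
    ∀ f : L.domain, ∀ x, (L f : Lp ℝ 2 m) x = G.lap m ((f : Lp ℝ 2 m) : X → ℝ) x

/-! ## The compactification, the boundary and the trace -/

/-- The algebra `D(Q^(N)) ∩ ℓ^∞(X)`. -/
def bddDom : Set (X → ℝ) := {f | f ∈ G.neumannDom m ∧ ∃ K : ℝ, ∀ x, |f x| ≤ K}

/-- The family of all values at `x` of functions in `D(Q^(N)) ∩ ℓ^∞(X)`. -/
def evalAt (x : X) : G.bddDom m → ℝ := fun f => f.1 x

/-- The compactification `X̂` of `X`: the closure of `X` in the product of copies of `ℝ` indexed by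
`D(Q^(N)) ∩ ℓ^∞(X)`.  Its defining properties (a compact Hausdorff space in which `X` is dense and
consists of open points, to which all functions in `D(Q^(N)) ∩ ℓ^∞(X)` extend continuously, the
extensions separating the points) are proved below. -/
def Hat : Type _ := ↥(closure (range (G.evalAt m)))

instance : TopologicalSpace (G.Hat m) :=
  inferInstanceAs (TopologicalSpace ↥(closure (range (G.evalAt m))))

/-- The inclusion of `X` in `X̂`. -/
def incl (x : X) : G.Hat m := ⟨G.evalAt m x, subset_closure ⟨x, rfl⟩⟩

/-- The continuous extension to `X̂` of a function in `D(Q^(N)) ∩ ℓ^∞(X)`. -/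
def bddExt (f : G.bddDom m) (p : G.Hat m) : ℝ := p.1 f

/-- The extension of `f ∈ D(Q^(N))` to `X̂` with values in `[-∞, ∞]`: its value at `p` is the limit
of `f x` as `x ∈ X` tends to `p`.  It exists and is continuous in `p`, as proved below. -/
def ext (f : X → ℝ) (p : G.Hat m) : EReal :=
  limUnder (comap (G.incl m) (𝓝 p)) (fun x => (f x : EReal))

/-- The `1`-harmonic boundary `∂X`. -/
def Bdry : Type _ :=
  {p : G.Hat m // p ∉ range (G.incl m) ∧
    ∀ f : G.bddDom m, (f : X → ℝ) ∈ G.dirichletDom m → G.bddExt m f p = 0}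

instance : TopologicalSpace (G.Bdry m) := instTopologicalSpaceSubtype

instance : MeasurableSpace (G.Bdry m) := borel _

instance : BorelSpace (G.Bdry m) := ⟨rfl⟩

/-- The trace `γ f` of `f ∈ D(Q^(N))` on the boundary. -/
def trace (f : X → ℝ) (z : G.Bdry m) : EReal := G.ext m f z.1

/-- The preliminary trace `γ₀ f` of `f ∈ D(Q^(N)) ∩ ℓ^∞(X)`. -/
def trace₀ (f : G.bddDom m) (z : G.Bdry m) : ℝ := G.bddExt m f z.1

/-! ### The properties of the compactification -/

instance : T2Space (G.Hat m) :=
  inferInstanceAs (T2Space ↥(closure (range (G.evalAt m))))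

theorem continuous_bddExt (f : G.bddDom m) : Continuous (G.bddExt m f) :=
  (continuous_apply f).comp continuous_subtype_val

theorem bddExt_incl (f : G.bddDom m) (x : X) : G.bddExt m f (G.incl m x) = f.1 x := rfl

theorem bddExt_separates {p q : G.Hat m} (h : ∀ f, G.bddExt m f p = G.bddExt m f q) : p = q :=
  Subtype.ext (funext h)

theorem denseRange_incl : DenseRange (G.incl m) := by
  intro p
  refine (closure_subtype (s := range (G.incl m)) (x := p)).2 ?_
  have : (Subtype.val '' range (G.incl m)) = range (G.evalAt m) := by
    ext q
    constructor
    · rintro ⟨_, ⟨x, rfl⟩, rfl⟩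
      exact ⟨x, rfl⟩
    · rintro ⟨x, rfl⟩
      exact ⟨_, ⟨x, rfl⟩, rfl⟩
  exact closure_mono this.ge p.2

instance : CompactSpace (G.Hat m) := by
  choose K hK using fun f : G.bddDom m => f.2.2
  refine isCompact_iff_compactSpace.mp ?_
  refine (isCompact_univ_pi (fun f : G.bddDom m => isCompact_Icc (a := -K f) (b := K f))).of_isClosed_subset
    isClosed_closure ?_
  refine closure_minimal ?_ (isCompact_univ_pi fun f => isCompact_Icc).isClosed
  rintro _ ⟨x, rfl⟩ f _
  exact abs_le.mp (hK f x)

theorem single_mem_bddDom [DecidableEq X] [Countable X] [DiscreteMeasurableSpace X]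
    (hm : ∀ x, m {x} < ∞) (x : X) : (Pi.single x 1 : X → ℝ) ∈ G.bddDom m := by
  refine ⟨⟨?_, G.energy_single_lt_top x⟩, 1, fun y => ?_⟩
  · have h : (Pi.single x 1 : X → ℝ) = indicator {x} (fun _ => (1 : ℝ)) := by
      ext y
      by_cases hy : y = x
      · subst hy; simp
      · simp [hy]
    rw [h]
    exact memLp_indicator_const 2 (measurableSet_singleton x) 1 (Or.inr (hm x).ne)
  · by_cases hy : y = x
    · subst hy; simp
    · simp [hy]

theorem injective_incl [Countable X] [DiscreteMeasurableSpace X]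
    (hm : ∀ x, m {x} < ∞) : Function.Injective (G.incl m) := by
  classical
  intro x y h
  have h2 := congrArg (G.bddExt m ⟨_, G.single_mem_bddDom m hm x⟩) h
  simp only [bddExt_incl] at h2
  by_contra hxy
  simp [Ne.symm hxy] at h2

theorem isOpen_singleton_incl [Countable X] [DiscreteMeasurableSpace X]
    (hm : ∀ x, m {x} < ∞) (x : X) : IsOpen {G.incl m x} := by
  classical
  set e := G.bddExt m ⟨_, G.single_mem_bddDom m hm x⟩ with he
  have hU : IsOpen {p | 1 / 2 < e p} :=
    isOpen_lt continuous_const (G.continuous_bddExt m _)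
  have hsub : {p | 1 / 2 < e p} = {G.incl m x} := by
    refine Subset.antisymm ?_ ?_
    · refine ((G.denseRange_incl m).open_subset_closure_inter hU).trans ?_
      refine closure_minimal ?_ isClosed_singleton
      rintro _ ⟨hp, ⟨y, rfl⟩⟩
      by_cases hy : y = x
      · subst hy; rfl
      · exfalso
        have : e (G.incl m y) = 0 := by simp [he, bddExt_incl, hy]
        have h3 : 1 / 2 < e (G.incl m y) := hp
        rw [this] at h3
        norm_num at h3
    · rintro _ rfl
      have : e (G.incl m x) = 1 := by simp [he, bddExt_incl]
      simp only [mem_ofPred_eq, this]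
      norm_num
  rw [← hsub]
  exact hU

theorem lipschitzWith_arctan : LipschitzWith 1 Real.arctan := by
  refine lipschitzWith_of_nnnorm_deriv_le Real.differentiable_arctan fun x => ?_
  rw [← NNReal.coe_le_coe, coe_nnnorm, Real.deriv_arctan, Real.norm_eq_abs, abs_of_nonneg (by positivity),
    div_le_iff₀ (by positivity)]
  simpa using sq_nonneg x

theorem arctan_mem_bddDom {f : X → ℝ} (hf : f ∈ G.neumannDom m) :
    (fun x => Real.arctan (f x)) ∈ G.bddDom m := by
  have h0 : ∀ t, |Real.arctan t| ≤ |t| := fun t => by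
    simpa [Real.dist_eq] using lipschitzWith_arctan.dist_le_mul t 0
  refine ⟨⟨?_, ?_⟩, Real.pi / 2, fun x => abs_le.2
    ⟨(Real.neg_pi_div_two_lt_arctan _).le, (Real.arctan_lt_pi_div_two _).le⟩⟩
  · refine hf.1.of_le (Real.continuous_arctan.comp_aestronglyMeasurable hf.1.1)
      (Eventually.of_forall fun x => ?_)
    simpa using h0 (f x)
  · refine lt_of_le_of_lt ?_ hf.2
    refine add_le_add (mul_le_mul_right (ENNReal.tsum_le_tsum fun x => ENNReal.tsum_le_tsum
      fun y => ENNReal.ofReal_le_ofReal (mul_le_mul_of_nonneg_left (sq_le_sq.2 ?_)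
        (G.b_nonneg _ _))) _) (ENNReal.tsum_le_tsum fun x => ENNReal.ofReal_le_ofReal
          (mul_le_mul_of_nonneg_left (sq_le_sq.2 (h0 _)) (G.c_nonneg _)))
    simpa [Real.dist_eq] using lipschitzWith_arctan.dist_le_mul (f x) (f y)

theorem exists_continuous_ext {f : X → ℝ} (hf : f ∈ G.neumannDom m) :
    ∃ F : G.Hat m → EReal, Continuous F ∧ ∀ x, F (G.incl m x) = f x := by
  classical
  let T : ℝ → EReal := fun t =>
    if t ≤ -(Real.pi / 2) then ⊥ else if Real.pi / 2 ≤ t then ⊤ else (Real.tan t : EReal)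
  have hTa : ∀ r : ℝ, T (Real.arctan r) = r := fun r => by
    have h1 := Real.neg_pi_div_two_lt_arctan r
    have h2 := Real.arctan_lt_pi_div_two r
    simp only [T]
    rw [if_neg (by linarith), if_neg (by linarith), Real.tan_arctan]
  have hmono : Monotone T := by
    intro s t hst
    simp only [T]
    by_cases h1 : s ≤ -(Real.pi / 2)
    · rw [if_pos h1]; exact bot_le
    by_cases h2 : Real.pi / 2 ≤ t
    · rw [if_neg (by linarith [Real.pi_pos] : ¬ t ≤ -(Real.pi / 2)), if_pos h2]; exact le_top
    rw [if_neg h1, if_neg (by linarith), if_neg (by linarith), if_neg h2]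
    push Not at h1 h2
    exact EReal.coe_le_coe_iff.2
      (Real.strictMonoOn_tan.monotoneOn ⟨h1, by linarith⟩ ⟨by linarith, h2⟩ hst)
  have hsurj : Function.Surjective T := by
    intro r
    induction r with
    | bot => exact ⟨-(Real.pi / 2), by simp [T]⟩
    | coe r => exact ⟨_, hTa r⟩
    | top =>
      refine ⟨Real.pi / 2, ?_⟩
      have : ¬ Real.pi / 2 ≤ -(Real.pi / 2) := by linarith [Real.pi_pos]
      simp only [T]
      rw [if_neg this, if_pos le_rfl]
  refine ⟨fun p => T (G.bddExt m ⟨_, G.arctan_mem_bddDom m hf⟩ p),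
    (hmono.continuous_of_surjective hsurj).comp (G.continuous_bddExt m _), fun x => hTa _⟩

theorem ext_eq_of_continuous {f : X → ℝ} {F : G.Hat m → EReal} (hF : Continuous F)
    (hFf : ∀ x, F (G.incl m x) = f x) : G.ext m f = F := by
  ext1 p
  have : (comap (G.incl m) (𝓝 p)).NeBot :=
    comap_neBot fun t ht => by
      obtain ⟨_, hq, x, rfl⟩ := mem_closure_iff_nhds.1 (G.denseRange_incl m p) t ht
      exact ⟨x, hq⟩
  refine Tendsto.limUnder_eq ?_
  have := (hF.tendsto p).comp (tendsto_comap (f := G.incl m) (x := 𝓝 p))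
  exact this.congr hFf

theorem continuous_ext {f : X → ℝ} (hf : f ∈ G.neumannDom m) : Continuous (G.ext m f) := by
  obtain ⟨F, hF, hFf⟩ := G.exists_continuous_ext m hf
  rwa [G.ext_eq_of_continuous m hF hFf]

theorem ext_incl {f : X → ℝ} (hf : f ∈ G.neumannDom m) (x : X) :
    G.ext m f (G.incl m x) = f x := by
  obtain ⟨F, hF, hFf⟩ := G.exists_continuous_ext m hf
  rw [G.ext_eq_of_continuous m hF hFf, hFf]

theorem trace_eq_trace₀ (f : G.bddDom m) (z : G.Bdry m) :
    G.trace m f z = (G.trace₀ m f z : EReal) :=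
  congrFun (G.ext_eq_of_continuous m (f := f.1) (F := fun p => (G.bddExt m f p : EReal))
    (continuous_coe_real_ereal.comp (G.continuous_bddExt m f)) fun _ => rfl) z.1

/-! ## Harmonic measures, normal derivatives and Robin boundary conditions -/

/-- `h` is the `1`-harmonic extension `H φ` of `φ : ∂X → [-∞, ∞]`. -/
def IsHarmonicExt (φ : G.Bdry m → EReal) (h : X → ℝ) : Prop :=
  h ∈ G.neumannDom m ∧ (∀ x, G.lap m h x + h x = 0) ∧ G.trace m h = φ

/-- `μ` is the `1`-harmonic measure `μ_o`: a Radon measure on `∂X` of mass at most one with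
`H φ (o) = ∫ φ dμ` for all `φ ∈ ran γ₀`, which, if `1 ∉ D(Q^(N))`, does not charge the point of
`∂X` at which all functions in `ran γ₀` vanish. -/
structure IsHarmonicMeasure (o : X) (μ : Measure (G.Bdry m)) : Prop where
  regular : μ.Regular
  mass_le : μ univ ≤ 1
  repr : ∀ (f : G.bddDom m) (h : X → ℝ), G.IsHarmonicExt m (fun z => (G.trace₀ m f z : EReal)) h →
    h o = ∫ z, G.trace₀ m f z ∂μ
  infty : (fun _ => (1 : ℝ)) ∉ G.neumannDom m →
    ∀ z : G.Bdry m, (∀ f : G.bddDom m, G.trace₀ m f z = 0) → μ {z} = 0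

/-- The functional `∂ₙ f` on `D(Q^(N))`, for `f ∈ D(Q^(N))` with `ℒ f ∈ ℓ²(X, m)`. -/
def normalFunctional (f g : X → ℝ) : ℝ :=
  G.energyBilin f g - ∫ x, G.lap m f x * g x ∂m

variable (μ : Measure (G.Bdry m))

/-- The domain of `∂_{n,μ}`: functions whose normal derivative is given by a function `φ` in
`L²(∂X, μ)`. -/
def normalDerivDom : Set (X → ℝ) :=
  {f | f ∈ G.neumannDom m ∧ MemLp (G.lap m f) 2 m ∧ ∃ φ : Lp ℝ 2 μ, ∀ g ∈ G.neumannDom m,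
    ∫ z, φ z * (G.trace m g z).toReal ∂μ = G.normalFunctional m f g}

open Classical in
/-- The normal derivative `∂_{n,μ} f` with respect to `μ`. -/
def normalDeriv (f : X → ℝ) : Lp ℝ 2 μ :=
  if h : f ∈ G.normalDerivDom m μ then h.2.2.choose else 0

/-- The kernel of `∂_{n,μ}`. -/
def normalDerivKer : Set (X → ℝ) :=
  {f | f ∈ G.normalDerivDom m μ ∧ G.normalDeriv m μ f = 0}

variable (β : G.Bdry m → ℝ≥0∞)

/-- `∫_{∂X} |f|² β dμ`, an integral with values in `[0, ∞]`. -/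
def bdryEnergy (f : X → ℝ) : ℝ≥0∞ := ∫⁻ z, (G.trace m f z).abs ^ 2 * β z ∂μ

/-- `∫_{∂X} f g β dμ`, the integral of `f g` with respect to the measure `β μ`, for `f, g` with
square integrable traces. -/
def bdryBilin (f g : X → ℝ) : ℝ :=
  ∫ z, (G.trace m f z).toReal * (G.trace m g z).toReal ∂(μ.withDensity β)

/-- The form `Q^β`. -/
def robinForm : HForm (Lp ℝ 2 m) where
  dom := {f | (f : X → ℝ) ∈ G.neumannDom m ∧ G.bdryEnergy m μ β f < ∞}
  val f g := G.energyBilin f g + G.bdryBilin m μ β f g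

/-- The support `F_β` of the measure `1_{β = ∞} μ`. -/
def bdryF : Set (G.Bdry m) :=
  {z | ∀ U : Set (G.Bdry m), IsOpen U → z ∈ U → 0 < μ ({w | β w = ∞} ∩ U)}

/-- The domain `D(L^β)` of the Laplacian with generalized Robin boundary conditions: `f = 0` on
`F_β`, and `(β + ∂ₙ) f = 0` on `∂X \ F_β` in the weak sense. -/
def robinDom : Set (X → ℝ) :=
  {f | f ∈ G.neumannDom m ∧ MemLp (G.lap m f) 2 m ∧ G.bdryEnergy m μ β f < ∞ ∧
    (∀ z ∈ G.bdryF m μ β, G.trace m f z = 0) ∧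
    ∀ g ∈ G.neumannDom m, G.bdryEnergy m μ β g < ∞ → (∀ z ∈ G.bdryF m μ β, G.trace m g z = 0) →
      G.normalFunctional m f g + G.bdryBilin m μ β f g = 0}

end WGraph

end

/-! The Neumann domain with the inner product 𝒬(f, g) + ⟨f, g⟩ is a Hilbert space N. On it point
evaluations are continuous, and normal contractions do not increase the norm. Let D be the closure
of the finitely supported functions in N. By Green's formula for indicator functions, elements of
D^⊥ solve ℒh + h = 0, so orthogonal projection onto D^⊥ produces 1-harmonic extensions
(`exists_isHarmonicExt`).

Two facts link N with the boundary. First, D is the kernel of the trace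
(`mem_DSpace_iff_trace_eq_zero`): if f vanishes on ∂X, the compact set {|f| ≥ ε} of X̂ avoids ∂X and
is therefore dominated by an element of D. Since D is an order ideal closed under norm bounded
pointwise limits, truncations of f and then f itself belong to D. Second, the trace is continuous
from N to convergence in μ-measure (`lintegral_min_trace_le`): the integral of min(|f|, 1) is the
value at o of a harmonic extension, hence at most a constant times the norm of f. Almost sure
convergence along subsequences and Fatou's lemma make the boundary energy lower semicontinuous, and
Q^β is closed. It is Markovian because contractions decrease both the energy and |f|.

Each form contains the indicators of points and acts on them as 𝒬 does, so its operator is a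
restriction of ℒ (`exists_lapRestriction`), and the weak equation becomes the boundary condition.
Vanishing on F_β is automatic for finite boundary energy. For β = ∞ on a connected graph, a
nonnegative harmonic extension vanishing at o is zero, so functions with μ-a.e. zero trace lie in D.
Finally, by Stone–Weierstrass only the zero density in L²(μ) annihilates all bounded traces, which
identifies the kernel of ∂_{n,μ}. -/

set_option linter.unusedSectionVars false

noncomputable section

/-! ## The Hilbert space of a closed form and the operator of a form -/

namespace HForm

section Space

variable {H : Type*} [NormedAddCommGroup H] [InnerProductSpace ℝ H] {Q : HForm H}

/-- The domain of a form as a linear subspace. -/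
def IsForm.submodule (hQ : Q.IsForm) : Submodule ℝ H where
  carrier := Q.dom
  zero_mem' := hQ.zero_mem
  add_mem' := fun ha hb => hQ.add_mem _ ha _ hb
  smul_mem' := fun a _ hf => hQ.smul_mem a _ hf

/-- The domain of a form, with the inner product `Q(f, g) + ⟨f, g⟩`. -/
def IsForm.Space (hQ : Q.IsForm) : Type _ := hQ.submodule

namespace IsForm

instance (hQ : Q.IsForm) : AddCommGroup hQ.Space := inferInstanceAs (AddCommGroup hQ.submodule)

instance (hQ : Q.IsForm) : Module ℝ hQ.Space := inferInstanceAs (Module ℝ hQ.submodule)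

/-- An element of the domain as an element of the form space. -/
def ofDom (hQ : Q.IsForm) (f : H) (hf : f ∈ Q.dom) : hQ.Space := ⟨f, hf⟩

/-- The inclusion of the form space in `H`. -/
def toH (hQ : Q.IsForm) : hQ.Space →ₗ[ℝ] H := hQ.submodule.subtype

theorem toH_mem (hQ : Q.IsForm) (f : hQ.Space) : hQ.toH f ∈ Q.dom := f.2

@[simp]
theorem toH_ofDom (hQ : Q.IsForm) (f : H) (hf : f ∈ Q.dom) : hQ.toH (hQ.ofDom f hf) = f := rfl

theorem toH_injective (hQ : Q.IsForm) : Function.Injective hQ.toH := Subtype.val_injective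

theorem val_add_right (hQ : Q.IsForm) {f g h : H} (hf : f ∈ Q.dom) (hg : g ∈ Q.dom)
    (hh : h ∈ Q.dom) : Q.val f (g + h) = Q.val f g + Q.val f h := by
  simpa using hQ.linear f hf g hg h hh 1 1

theorem val_smul_right (hQ : Q.IsForm) {f g : H} (hf : f ∈ Q.dom) (hg : g ∈ Q.dom) (a : ℝ) :
    Q.val f (a • g) = a * Q.val f g := by
  simpa using hQ.linear f hf g hg g hg a 0

/-- The inner product of the form space. -/
@[reducible]
def core (hQ : Q.IsForm) : InnerProductSpace.Core ℝ hQ.Space where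
  inner f g := Q.val (hQ.toH f) (hQ.toH g) + inner ℝ (hQ.toH f) (hQ.toH g)
  conj_inner_symm f g := by
    simp only [conj_trivial]
    rw [hQ.symm _ (hQ.toH_mem g) _ (hQ.toH_mem f), real_inner_comm]
  re_inner_nonneg f := by
    simpa using add_nonneg (hQ.nonneg _ (hQ.toH_mem f)) (real_inner_self_nonneg (x := hQ.toH f))
  add_left f g h := by
    simp only [map_add, inner_add_left]
    rw [hQ.symm _ (hQ.add_mem _ (hQ.toH_mem f) _ (hQ.toH_mem g)) _ (hQ.toH_mem h),
      hQ.val_add_right (hQ.toH_mem h) (hQ.toH_mem f) (hQ.toH_mem g),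
      hQ.symm _ (hQ.toH_mem h) _ (hQ.toH_mem f), hQ.symm _ (hQ.toH_mem h) _ (hQ.toH_mem g)]
    ring
  smul_left f g a := by
    simp only [map_smul, real_inner_smul_left, conj_trivial]
    rw [hQ.symm _ (hQ.smul_mem _ _ (hQ.toH_mem f)) _ (hQ.toH_mem g),
      hQ.val_smul_right (hQ.toH_mem g) (hQ.toH_mem f), hQ.symm _ (hQ.toH_mem g) _ (hQ.toH_mem f)]
    ring
  definite f h := by
    have h1 := hQ.nonneg _ (hQ.toH_mem f)
    have h2 := real_inner_self_nonneg (x := hQ.toH f)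
    have h3 : inner ℝ (hQ.toH f) (hQ.toH f) = 0 := by linarith
    exact hQ.toH_injective (by simpa using inner_self_eq_zero.1 h3)

instance (hQ : Q.IsForm) : NormedAddCommGroup hQ.Space := hQ.core.toNormedAddCommGroup

instance (hQ : Q.IsForm) : InnerProductSpace ℝ hQ.Space := InnerProductSpace.ofCore hQ.core.toCore

theorem inner_def (hQ : Q.IsForm) (f g : hQ.Space) :
    inner ℝ f g = Q.val (hQ.toH f) (hQ.toH g) + inner ℝ (hQ.toH f) (hQ.toH g) := rfl

theorem norm_sq_eq (hQ : Q.IsForm) (f : hQ.Space) : ‖f‖ ^ 2 = Q.normSq (hQ.toH f) := by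
  rw [← real_inner_self_eq_norm_sq, inner_def, normSq, real_inner_self_eq_norm_sq]

theorem norm_toH_le (hQ : Q.IsForm) (f : hQ.Space) : ‖hQ.toH f‖ ≤ ‖f‖ := by
  refine le_of_sq_le_sq ?_ (norm_nonneg _)
  rw [norm_sq_eq, normSq]
  linarith [hQ.nonneg _ (hQ.toH_mem f)]

theorem completeSpace (hQ : Q.IsForm) (hc : Q.Closed) : CompleteSpace hQ.Space := by
  refine Metric.complete_of_cauchySeq_tendsto fun u hu => ?_
  obtain ⟨f, hf, hlim⟩ := hc (fun n => hQ.toH (u n)) (fun n => hQ.toH_mem _) fun ε hε => by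
    obtain ⟨N, hN⟩ := Metric.cauchySeq_iff.1 hu (√ε) (Real.sqrt_pos.2 hε)
    refine ⟨N, fun n hn k hk => ?_⟩
    rw [← map_sub, ← norm_sq_eq, ← dist_eq_norm, ← Real.sq_sqrt hε.le]
    exact pow_lt_pow_left₀ (hN n hn k hk) dist_nonneg two_ne_zero
  refine ⟨hQ.ofDom f hf, tendsto_iff_norm_sub_tendsto_zero.2 ?_⟩
  have h2 : Tendsto (fun n => √(Q.normSq (hQ.toH (u n) - f))) atTop (𝓝 0) := by
    simpa [Function.comp_def] using (Real.continuous_sqrt.tendsto 0).comp hlim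
  refine h2.congr fun n => ?_
  rw [← Real.sqrt_sq (norm_nonneg (u n - hQ.ofDom f hf)), norm_sq_eq, map_sub, toH_ofDom]

/-- The solution of `Q(f, ·) + ⟨f, ·⟩ = ⟨v, ·⟩`. -/
theorem exists_resolvent (hQ : Q.IsForm) (hc : Q.Closed) (v : H) :
    ∃ w ∈ Q.dom, ∀ g ∈ Q.dom, Q.val w g + inner ℝ w g = inner ℝ v g := by
  have := hQ.completeSpace hc
  -- Riesz representation in the form space: its embedding in H is a contraction, so ⟨v, ·⟩ is
  -- bounded on it.
  let l : hQ.Space →ₗ[ℝ] ℝ := (innerₛₗ ℝ v).comp hQ.toH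
  let L : hQ.Space →L[ℝ] ℝ := l.mkContinuous ‖v‖ fun f =>
    (norm_inner_le_norm v (hQ.toH f)).trans
      (mul_le_mul_of_nonneg_left (hQ.norm_toH_le f) (norm_nonneg v))
  refine ⟨hQ.toH ((InnerProductSpace.toDual ℝ _).symm L), hQ.toH_mem _, fun g hg => ?_⟩
  have h := InnerProductSpace.toDual_symm_apply (𝕜 := ℝ) (x := hQ.ofDom g hg) (y := L)
  rw [inner_def, toH_ofDom] at h
  exact h

/-- The graph of the operator of a form. -/
def graph (hQ : Q.IsForm) : Submodule ℝ (H × H) where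
  carrier := {p | p.1 ∈ Q.dom ∧ ∀ g ∈ Q.dom, Q.val g p.1 = inner ℝ g p.2}
  zero_mem' := ⟨hQ.zero_mem, fun g hg => by
    simpa using hQ.val_smul_right hg hQ.zero_mem 0⟩
  add_mem' := fun {a b} ha hb => ⟨hQ.add_mem _ ha.1 _ hb.1, fun g hg => by
    rw [Prod.fst_add, hQ.val_add_right hg ha.1 hb.1, ha.2 g hg, hb.2 g hg, Prod.snd_add,
      inner_add_right]⟩
  smul_mem' := fun a p hp => ⟨hQ.smul_mem _ _ hp.1, fun g hg => by
    rw [Prod.smul_fst, hQ.val_smul_right hg hp.1, hp.2 g hg, Prod.smul_snd,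
      real_inner_smul_right]⟩

/-- Density of the form domain makes the graph single-valued. -/
theorem graph_snd_eq_zero (hQ : Q.IsForm) (hd : Dense Q.dom) :
    ∀ p ∈ hQ.graph, p.1 = 0 → p.2 = 0 := by
  intro p hp h0
  refine hd.eq_zero_of_inner_right ℝ fun g hg => ?_
  rw [← hp.2 g hg, h0]
  simpa using hQ.val_smul_right hg hQ.zero_mem 0

/-- A closed densely defined form has an associated self-adjoint operator, and its domain is
described by the weak equation. -/
theorem exists_operator [CompleteSpace H] (hQ : Q.IsForm) (hc : Q.Closed) (hd : Dense Q.dom) :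
    ∃ L : H →ₗ.[ℝ] H, IsOperatorOf L Q ∧
      (∀ f, f ∈ L.domain ↔ f ∈ Q.dom ∧ ∃ v, ∀ g ∈ Q.dom, Q.val g f = inner ℝ g v) ∧
      ∀ f : L.domain, ∀ g ∈ Q.dom, Q.val g f = inner ℝ g (L f) := by
  set L := hQ.graph.toLinearPMap with hL
  have hdom : ∀ f, f ∈ L.domain ↔ f ∈ Q.dom ∧ ∃ v, ∀ g ∈ Q.dom, Q.val g f = inner ℝ g v := by
    intro f
    rw [hL, Submodule.toLinearPMap_domain, Submodule.mem_map]
    constructor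
    · rintro ⟨p, hp, rfl⟩
      exact ⟨hp.1, p.2, hp.2⟩
    · rintro ⟨hf, v, hv⟩
      exact ⟨(f, v), ⟨hf, hv⟩, rfl⟩
  have hval : ∀ f : L.domain, ∀ g ∈ Q.dom, Q.val g f = inner ℝ g (L f) := fun f =>
    (Submodule.mem_graph_toLinearPMap (hQ.graph_snd_eq_zero hd) f).2
  have hsub : ∀ f : L.domain, (f : H) ∈ Q.dom := fun f => ((hdom f).1 f.2).1
  -- Surjectivity of L + 1 is the only analytic input: density of the domain and self-adjointness
  -- both follow from it.
  have honto : ∀ v, ∃ w : L.domain, L w + (w : H) = v := by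
    intro v
    obtain ⟨w, hw, hwv⟩ := hQ.exists_resolvent hc v
    have hwg : ∀ g ∈ Q.dom, Q.val g w = inner ℝ g (v - w) := fun g hg => by
      rw [hQ.symm g hg w hw, inner_sub_right, real_inner_comm v g, real_inner_comm w g,
        ← hwv g hg]
      ring
    refine ⟨⟨w, (hdom w).2 ⟨hw, _, hwg⟩⟩, ?_⟩
    have : L ⟨w, (hdom w).2 ⟨hw, _, hwg⟩⟩ - (v - w) = 0 :=
      hd.eq_zero_of_inner_right ℝ fun g hg => by
        rw [inner_sub_right, ← hval _ g hg, ← hwg g hg, sub_self]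
    rw [sub_eq_zero.1 this]
    simp
  have hsymm : ∀ f g : L.domain, inner ℝ (L f) (g : H) = inner ℝ (f : H) (L g) := fun f g => by
    rw [real_inner_comm, ← hval f g (hsub g), ← hval g f (hsub f),
      hQ.symm _ (hsub g) _ (hsub f)]
  have hdense : Dense (L.domain : Set H) := by
    rw [Submodule.dense_iff_topologicalClosure_eq_top, Submodule.topologicalClosure_eq_top_iff,
      Submodule.eq_bot_iff]
    intro u hu
    -- For u = (L + 1) w orthogonal to the domain, 0 = ⟨w, u⟩ = Q(w) + ‖w‖², so w = 0.
    obtain ⟨w, hw⟩ := honto u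
    have h0 : inner ℝ (w : H) u = 0 := (Submodule.mem_orthogonal _ _).1 hu w w.2
    have h1 : Q.val w w + ‖(w : H)‖ ^ 2 = 0 := by
      rw [hval w w (hsub w), ← real_inner_self_eq_norm_sq, ← inner_add_right, hw, h0]
    have h2 := hQ.nonneg _ (hsub w)
    have h3 : (w : H) = 0 := by
      rw [← norm_eq_zero, ← sq_eq_zero_iff]
      nlinarith [sq_nonneg ‖(w : H)‖]
    have h4 : w = 0 := Subtype.ext h3
    rw [← hw, h4]
    simp
  refine ⟨L, ⟨hdense, ?_, fun g => ?_, fun f hf => hsub ⟨f, hf⟩, fun f hf g => hval g f hf⟩,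
    hdom, hval⟩
  · rw [LinearPMap.isSelfAdjoint_def]
    have hfa : L.IsFormalAdjoint L := fun f g => hsymm f g
    have hle : L ≤ L.adjoint := hfa.le_adjoint hdense
    refine (LinearPMap.eq_of_le_of_domain_eq hle (le_antisymm hle.1 fun u hu => ?_)).symm
    -- With (L + 1) w = (L* + 1) u, the vector u - w is orthogonal to the range of L + 1, which is
    -- all of H; hence u = w.
    obtain ⟨w, hw⟩ := honto (L.adjoint ⟨u, hu⟩ + u)
    have key : u - w = 0 := by
      rw [← inner_self_eq_zero (𝕜 := ℝ)]
      obtain ⟨g, hg⟩ := honto (u - w)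
      have h1 : inner ℝ (L.adjoint ⟨u, hu⟩) (g : H) = inner ℝ u (L g) :=
        L.adjoint_isFormalAdjoint hdense ⟨u, hu⟩ g
      have h2 : inner ℝ (L w + w : H) (g : H) = inner ℝ (w : H) (L g + g) := by
        rw [inner_add_left, inner_add_right, hsymm w g]
      nth_rewrite 2 [← hg]
      rw [inner_sub_left, ← h2, hw, inner_add_left, inner_add_right, h1]
      ring
    rw [sub_eq_zero.1 key]
    exact w.2
  · rw [real_inner_comm, ← hval g g (hsub g)]
    exact hQ.nonneg _ (hsub g)

end IsForm

end Space

end HForm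

/-! ## Functions of finite energy -/

/-- Fatou's lemma for series, through finite partial sums. -/
theorem ENNReal.tsum_le_of_tendsto {ι : Type*} {a : ℕ → ι → ℝ≥0∞} {a₀ : ι → ℝ≥0∞} {C : ℝ≥0∞}
    (h : ∀ i, Tendsto (fun n => a n i) atTop (𝓝 (a₀ i))) (hC : ∀ᶠ n in atTop, ∑' i, a n i ≤ C) :
    ∑' i, a₀ i ≤ C := by
  rw [ENNReal.tsum_eq_iSup_sum]
  refine iSup_le fun s => le_of_tendsto (tendsto_finsetSum s fun i _ => h i) ?_
  filter_upwards [hC] with n hn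
  exact (ENNReal.sum_le_tsum s).trans hn

theorem summable_mul_mul_of_sq {ι : Type*} {w u v : ι → ℝ} (hw : ∀ i, 0 ≤ w i)
    (hu : Summable fun i => w i * u i ^ 2) (hv : Summable fun i => w i * v i ^ 2) :
    Summable fun i => w i * u i * v i := by
  refine Summable.of_norm_bounded (hu.add hv) fun i => ?_
  rw [Real.norm_eq_abs, mul_assoc, abs_mul, abs_of_nonneg (hw i), ← mul_add]
  refine mul_le_mul_of_nonneg_left (abs_le.2 ⟨?_, ?_⟩) (hw i)
  · nlinarith [sq_nonneg (u i + v i), sq_nonneg (u i), sq_nonneg (v i)]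
  · nlinarith [sq_nonneg (u i - v i), sq_nonneg (u i), sq_nonneg (v i)]

namespace WGraph

variable {X : Type*} (G : WGraph X)

/-- The weights of the terms of the energy. -/
def wt : (X × X) ⊕ X → ℝ := Sum.elim (fun p => 1 / 2 * G.b p.1 p.2) G.c

/-- The differences of `f` along all pairs, and its values. -/
def grad (f : X → ℝ) : (X × X) ⊕ X → ℝ := Sum.elim (fun p => f p.1 - f p.2) f

theorem wt_nonneg (i : (X × X) ⊕ X) : 0 ≤ G.wt i := by
  rcases i with p | x
  · exact mul_nonneg (by norm_num) (G.b_nonneg _ _)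
  · exact G.c_nonneg x

theorem grad_add (f g : X → ℝ) (i : (X × X) ⊕ X) : grad (f + g) i = grad f i + grad g i := by
  rcases i with p | x
  · simp only [grad, Sum.elim_inl, Pi.add_apply]; ring
  · simp [grad]

theorem grad_smul (a : ℝ) (f : X → ℝ) (i : (X × X) ⊕ X) : grad (a • f) i = a * grad f i := by
  rcases i with p | x
  · simp only [grad, Sum.elim_inl, Pi.smul_apply, smul_eq_mul]; ring
  · simp [grad]

theorem abs_grad_comp_le {C : ℝ → ℝ} (hC : LipschitzWith 1 C) (hC0 : C 0 = 0) (f : X → ℝ)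
    (i : (X × X) ⊕ X) : |grad (fun x => C (f x)) i| ≤ |grad f i| := by
  rcases i with p | x
  · simpa [grad, Real.dist_eq] using hC.dist_le_mul (f p.1) (f p.2)
  · simpa [grad, Real.dist_eq, hC0] using hC.dist_le_mul (f x) 0

theorem tendsto_grad {u : ℕ → X → ℝ} {f : X → ℝ} (h : ∀ x, Tendsto (fun n => u n x) atTop (𝓝 (f x)))
    (i : (X × X) ⊕ X) : Tendsto (fun n => grad (u n) i) atTop (𝓝 (grad f i)) := by
  rcases i with p | x
  · exact (h p.1).sub (h p.2)
  · exact h x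

/-- A single series over (X × X) ⊕ X, with the factor 1/2 in the weight, lets most energy
computations proceed term by term. -/
theorem energy_eq_tsum (f : X → ℝ) :
    G.energy f = ∑' i, ENNReal.ofReal (G.wt i * grad f i ^ 2) := by
  rw [Summable.tsum_sum (f := fun i => ENNReal.ofReal (G.wt i * grad f i ^ 2))
    ENNReal.summable ENNReal.summable, energy]
  congr 1
  rw [ENNReal.tsum_prod', ← ENNReal.tsum_mul_left]
  refine tsum_congr fun x => ?_
  rw [← ENNReal.tsum_mul_left]
  refine tsum_congr fun y => ?_
  simp only [wt, grad, Sum.elim_inl]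
  rw [mul_assoc, ENNReal.ofReal_mul (p := 1 / 2) (by norm_num)]
  congr 1
  rw [one_div, ENNReal.ofReal_inv_of_pos (by norm_num)]
  simp

/-- `f` has finite energy. -/
def FinEnergy (f : X → ℝ) : Prop := Summable fun i => G.wt i * grad f i ^ 2

theorem term_nonneg (f : X → ℝ) (i : (X × X) ⊕ X) : 0 ≤ G.wt i * grad f i ^ 2 :=
  mul_nonneg (G.wt_nonneg i) (sq_nonneg _)

theorem energy_lt_top_iff {f : X → ℝ} : G.energy f < ∞ ↔ G.FinEnergy f := by
  rw [energy_eq_tsum]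
  constructor
  · intro h
    have := ENNReal.summable_toReal h.ne
    exact this.congr fun i => ENNReal.toReal_ofReal (G.term_nonneg f i)
  · exact fun h => h.tsum_ofReal_lt_top

variable {G}

namespace FinEnergy

variable {f g h : X → ℝ}

theorem summable_mul (hf : G.FinEnergy f) (hg : G.FinEnergy g) :
    Summable fun i => G.wt i * grad f i * grad g i :=
  summable_mul_mul_of_sq G.wt_nonneg hf hg

theorem energyBilin_eq (hf : G.FinEnergy f) (hg : G.FinEnergy g) :
    G.energyBilin f g = ∑' i, G.wt i * grad f i * grad g i := by
  have hs := hf.summable_mul hg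
  rw [Summable.tsum_sum (f := fun i => G.wt i * grad f i * grad g i)
    (hs.comp_injective Sum.inl_injective) (hs.comp_injective Sum.inr_injective), energyBilin,
    ← tsum_mul_left]
  congr 1
  refine tsum_congr fun p => ?_
  simp only [wt, grad, Sum.elim_inl]
  ring

theorem energyBilin_self (hf : G.FinEnergy f) :
    G.energyBilin f f = ∑' i, G.wt i * grad f i ^ 2 := by
  rw [hf.energyBilin_eq hf]
  exact tsum_congr fun i => by ring

theorem energyBilin_self_nonneg (hf : G.FinEnergy f) : 0 ≤ G.energyBilin f f := by
  rw [hf.energyBilin_self]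
  exact tsum_nonneg (G.term_nonneg f)

theorem energy_eq (hf : G.FinEnergy f) : G.energy f = ENNReal.ofReal (G.energyBilin f f) := by
  rw [energy_eq_tsum, hf.energyBilin_self, ENNReal.ofReal_tsum_of_nonneg (G.term_nonneg f) hf]

theorem energyBilin_comm (hf : G.FinEnergy f) (hg : G.FinEnergy g) :
    G.energyBilin f g = G.energyBilin g f := by
  rw [hf.energyBilin_eq hg, hg.energyBilin_eq hf]
  exact tsum_congr fun i => by ring

theorem smul (hf : G.FinEnergy f) (a : ℝ) : G.FinEnergy (a • f) :=
  (hf.mul_left (a ^ 2)).congr fun i => by rw [grad_smul]; ring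

theorem add (hf : G.FinEnergy f) (hg : G.FinEnergy g) : G.FinEnergy (f + g) :=
  ((Summable.add hf hg).add ((hf.summable_mul hg).mul_left 2)).congr fun i => by rw [grad_add]; ring

theorem energyBilin_linear (hf : G.FinEnergy f) (hg : G.FinEnergy g) (hh : G.FinEnergy h)
    (a b : ℝ) :
    G.energyBilin f (a • g + b • h) = a * G.energyBilin f g + b * G.energyBilin f h := by
  rw [hf.energyBilin_eq ((hg.smul a).add (hh.smul b)), hf.energyBilin_eq hg,
    hf.energyBilin_eq hh, ← tsum_mul_left, ← tsum_mul_left,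
    ← ((hf.summable_mul hg).mul_left a).tsum_add ((hf.summable_mul hh).mul_left b)]
  exact tsum_congr fun i => by rw [grad_add, grad_smul, grad_smul]; ring

theorem comp (hf : G.FinEnergy f) {C : ℝ → ℝ} (hC : LipschitzWith 1 C) (hC0 : C 0 = 0) :
    G.FinEnergy fun x => C (f x) :=
  Summable.of_nonneg_of_le (G.term_nonneg _) (fun i => mul_le_mul_of_nonneg_left
    (sq_le_sq.2 (abs_grad_comp_le hC hC0 f i)) (G.wt_nonneg i)) hf

theorem energyBilin_comp_le (hf : G.FinEnergy f) {C : ℝ → ℝ} (hC : LipschitzWith 1 C)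
    (hC0 : C 0 = 0) : G.energyBilin (fun x => C (f x)) (fun x => C (f x)) ≤ G.energyBilin f f := by
  rw [hf.energyBilin_self, (hf.comp hC hC0).energyBilin_self]
  exact (hf.comp hC hC0).tsum_le_tsum (fun i => mul_le_mul_of_nonneg_left
    (sq_le_sq.2 (abs_grad_comp_le hC hC0 f i)) (G.wt_nonneg i)) hf

/-- Product rule f(x)g(x) - f(y)g(y) = (f(x) - f(y))g(x) + f(y)(g(x) - g(y)), followed by (a + b)² ≤
2a² + 2b². -/
theorem mul (hf : G.FinEnergy f) (hg : G.FinEnergy g) {K K' : ℝ} (hK : ∀ x, |f x| ≤ K)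
    (hK' : ∀ x, |g x| ≤ K') : G.FinEnergy (f * g) := by
  refine Summable.of_nonneg_of_le (G.term_nonneg _) (fun i => ?_)
    ((hf.mul_left (2 * K' ^ 2)).add (hg.mul_left (2 * K ^ 2)))
  have hb : ∀ {u : X → ℝ} {k : ℝ}, (∀ x, |u x| ≤ k) → ∀ x, u x ^ 2 ≤ k ^ 2 := fun hu x =>
    sq_le_sq.2 ((hu x).trans (le_abs_self _))
  have key : grad (f * g) i ^ 2 ≤ 2 * K' ^ 2 * grad f i ^ 2 + 2 * K ^ 2 * grad g i ^ 2 := by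
    rcases i with ⟨x, y⟩ | x
    · simp only [grad, Sum.elim_inl, Pi.mul_apply]
      have h1 : f x * g x - f y * g y = (f x - f y) * g x + f y * (g x - g y) := by ring
      have h2 := mul_le_mul_of_nonneg_left (hb hK' x) (sq_nonneg (f x - f y))
      have h3 := mul_le_mul_of_nonneg_left (hb hK y) (sq_nonneg (g x - g y))
      rw [h1]
      nlinarith [sq_nonneg ((f x - f y) * g x - f y * (g x - g y))]
    · simp only [grad, Sum.elim_inr, Pi.mul_apply]
      have h2 := mul_le_mul_of_nonneg_left (hb hK' x) (sq_nonneg (f x))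
      have h3 := mul_nonneg (sq_nonneg K) (sq_nonneg (g x))
      have h4 := mul_nonneg (sq_nonneg K') (sq_nonneg (f x))
      nlinarith
  calc G.wt i * grad (f * g) i ^ 2 ≤ G.wt i * _ := mul_le_mul_of_nonneg_left key (G.wt_nonneg i)
    _ = _ := by ring

theorem summable_edge (hf : G.FinEnergy f) (x : X) :
    Summable fun y => G.b x y * (f x - f y) := by
  have h1 : Summable fun y => G.b x y * (f x - f y) ^ 2 := by
    have h := (Summable.comp_injective hf Sum.inl_injective).comp_injective
      (Prod.mk_right_injective x)
    refine (h.mul_left 2).congr fun y => ?_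
    simp only [Function.comp_apply, wt, grad, Sum.elim_inl]
    ring
  have h2 : Summable fun y => G.b x y * (1 : ℝ) ^ 2 := by simpa using G.b_summable x
  simpa using summable_mul_mul_of_sq (G.b_nonneg x) h2 h1

end FinEnergy

theorem energy_le_of_tendsto {u : ℕ → X → ℝ} {f : X → ℝ} {C : ℝ≥0∞}
    (h : ∀ x, Tendsto (fun n => u n x) atTop (𝓝 (f x)))
    (hC : ∀ᶠ n in atTop, G.energy (u n) ≤ C) : G.energy f ≤ C := by
  simp only [energy_eq_tsum] at hC ⊢
  refine ENNReal.tsum_le_of_tendsto (fun i => ?_) hC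
  exact (ENNReal.continuous_ofReal.tendsto _).comp
    (((tendsto_grad h i).pow 2).const_mul (G.wt i))

/-- Green's formula for the indicator function of a point. -/
theorem energyBilin_single [DecidableEq X] {f : X → ℝ} (hf : G.FinEnergy f) (x : X) :
    G.energyBilin (Pi.single x 1) f = ∑' y, G.b x y * (f x - f y) + G.c x * f x := by
  set S := ∑' y, G.b x y * (f x - f y) with hS
  have hsum : HasSum (fun y => G.b x y * (f x - f y)) S := (hf.summable_edge x).hasSum
  -- Only pairs with first entry x or second entry x contribute; the pair (x, x), common to both
  -- families, contributes zero. Each family sums to S by symmetry of b, and the factor 1/2 of the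
  -- energy removes the double count.
  have h1 : HasSum (fun p : X × X => if p.1 = x then G.b x p.2 * (f x - f p.2) else 0) S := by
    refine ((Prod.mk_right_injective x).hasSum_iff ?_).1 ?_
    · rintro ⟨u, v⟩ hp
      have : u ≠ x := fun h => hp ⟨v, by rw [h]⟩
      simp [this]
    · simpa [Function.comp_def] using hsum
  have h2 : HasSum (fun p : X × X => if p.2 = x then G.b x p.1 * (f x - f p.1) else 0) S := by
    refine ((Prod.mk_left_injective x).hasSum_iff ?_).1 ?_
    · rintro ⟨u, v⟩ hp
      have : v ≠ x := fun h => hp ⟨u, by rw [h]⟩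
      simp [this]
    · simpa [Function.comp_def] using hsum
  rw [energyBilin]
  congr 1
  · have : ∑' p : X × X, G.b p.1 p.2 * ((Pi.single x 1 : X → ℝ) p.1 - (Pi.single x 1 : X → ℝ) p.2)
        * (f p.1 - f p.2) = S + S := by
      rw [← (h1.add h2).tsum_eq]
      refine tsum_congr fun ⟨u, v⟩ => ?_
      by_cases hu : u = x <;> by_cases hv : v = x
      · subst hu; subst hv; simp
      · subst hu; simp [hv]
      · subst hv; simp only [hu, Pi.single_eq_same, Pi.single_eq_of_ne hu, if_false, if_true,
          G.b_symm u v]; ring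
      · simp [hu, hv]
    rw [this]
    ring
  · rw [tsum_eq_single x (fun y hy => by simp [hy])]
    simp

end WGraph

/-! ## Square summable functions on a discrete measure space -/

/-- All points have positive finite mass. -/
class FullAtoms {X : Type*} [MeasurableSpace X] (m : Measure X) : Prop where
  pos : ∀ x, 0 < m {x}
  lt_top : ∀ x, m {x} < ∞

namespace FullAtoms

variable {X : Type*} [Countable X] [MeasurableSpace X] [DiscreteMeasurableSpace X]
  {m : Measure X} [FullAtoms m]

/-- No point is null, so a class in ℓ² is a function and the `Lp` operations are pointwise
everywhere. -/
theorem eq_of_ae_eq {α : Type*} {f g : X → α} (h : f =ᵐ[m] g) : f = g := by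
  ext x
  by_contra hx
  have h0 : m {x} = 0 := measure_mono_null (by simpa using hx) (ae_iff.1 h)
  exact (pos x).ne' h0

theorem real_pos (m : Measure X) [FullAtoms m] (x : X) : 0 < m.real {x} :=
  ENNReal.toReal_pos (pos x).ne' (lt_top x).ne

theorem coe_add (f g : Lp ℝ 2 m) : ((f + g : Lp ℝ 2 m) : X → ℝ) = f + g :=
  eq_of_ae_eq (Lp.coeFn_add f g)

theorem coe_sub (f g : Lp ℝ 2 m) : ((f - g : Lp ℝ 2 m) : X → ℝ) = f - g :=
  eq_of_ae_eq (Lp.coeFn_sub f g)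

theorem coe_smul (a : ℝ) (f : Lp ℝ 2 m) : ((a • f : Lp ℝ 2 m) : X → ℝ) = a • ⇑f :=
  eq_of_ae_eq (Lp.coeFn_smul a f)

theorem coe_zero : ((0 : Lp ℝ 2 m) : X → ℝ) = 0 :=
  eq_of_ae_eq (Lp.coeFn_zero ℝ 2 m)

theorem coe_toLp {f : X → ℝ} (hf : MemLp f 2 m) : (hf.toLp f : X → ℝ) = f :=
  eq_of_ae_eq hf.coeFn_toLp

theorem coe_compLp {C : ℝ → ℝ} (hC : LipschitzWith 1 C) (hC0 : C 0 = 0) (f : Lp ℝ 2 m) :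
    (hC.compLp hC0 f : X → ℝ) = fun x => C (f x) :=
  eq_of_ae_eq (hC.coeFn_compLp hC0 f)

/-- The indicator function of a point. -/
def delta (m : Measure X) [FullAtoms m] (x : X) : Lp ℝ 2 m :=
  indicatorConstLp 2 (measurableSet_singleton x) (lt_top x).ne 1

theorem coe_delta [DecidableEq X] (x : X) : (delta m x : X → ℝ) = Pi.single x 1 := by
  rw [delta, eq_of_ae_eq (indicatorConstLp_coeFn (p := 2) (μ := m) (s := {x}) (c := (1 : ℝ))
    (hs := measurableSet_singleton x) (hμs := (lt_top x).ne))]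
  ext y
  by_cases hy : y = x
  · subst hy; simp
  · simp [hy]

theorem inner_delta (x : X) (f : Lp ℝ 2 m) : inner ℝ (delta m x) f = m.real {x} * f x := by
  rw [delta, L2.inner_indicatorConstLp_one, Measure.restrict_singleton, integral_smul_measure,
    integral_dirac, smul_eq_mul, measureReal_def]

theorem continuous_eval (x : X) : Continuous fun f : Lp ℝ 2 m => (f : X → ℝ) x := by
  have h : (fun f : Lp ℝ 2 m => (f : X → ℝ) x) =
      fun f => (m.real {x})⁻¹ * inner ℝ (delta m x) f := by
    ext f
    rw [inner_delta, inv_mul_cancel_left₀ (real_pos m x).ne']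
  rw [h]
  exact continuous_const.mul (continuous_const.inner continuous_id)

theorem inner_eq_integral (f g : Lp ℝ 2 m) : inner ℝ f g = ∫ x, f x * g x ∂m := by
  rw [L2.inner_def]
  exact integral_congr_ae (Eventually.of_forall fun x => by simp [mul_comm])

theorem norm_sq_apply_le (f : Lp ℝ 2 m) (x : X) : m.real {x} * f x ^ 2 ≤ ‖f‖ ^ 2 := by
  have hd : inner ℝ (delta m x) (delta m x) = m.real {x} := by
    classical
    rw [inner_delta, coe_delta]
    simp
  have h := real_inner_mul_inner_self_le (delta m x) f
  rw [hd, inner_delta, real_inner_self_eq_norm_sq] at h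
  refine le_of_mul_le_mul_left ?_ (real_pos m x)
  linarith

/-- An element of ℓ² orthogonal to all indicators of points vanishes at every point. -/
theorem dense_of_delta_mem {Q : HForm (Lp ℝ 2 m)} (hQ : Q.IsForm)
    (h : ∀ x, delta m x ∈ Q.dom) : Dense Q.dom := by
  change Dense (hQ.submodule : Set (Lp ℝ 2 m))
  rw [Submodule.dense_iff_topologicalClosure_eq_top, Submodule.topologicalClosure_eq_top_iff,
    Submodule.eq_bot_iff]
  intro f hf
  have hx : ∀ x, f x = 0 := fun x => by
    have h1 := (Submodule.mem_orthogonal _ _).1 hf _ (h x)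
    rw [inner_delta] at h1
    exact (mul_eq_zero.1 h1).resolve_left (real_pos m x).ne'
  ext1
  exact Eventually.of_forall fun x => by rw [hx, coe_zero]; rfl

theorem memLp_comp {f : X → ℝ} (hf : MemLp f 2 m) {C : ℝ → ℝ} (hC : LipschitzWith 1 C)
    (hC0 : C 0 = 0) : MemLp (fun x => C (f x)) 2 m := by
  rw [← coe_toLp hf, ← coe_compLp hC hC0]
  exact Lp.memLp _

end FullAtoms

/-! ## The Neumann form -/

namespace WGraph

open FullAtoms

variable {X : Type*} [Countable X] [MeasurableSpace X] [DiscreteMeasurableSpace X]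
  (G : WGraph X) (m : Measure X)

theorem mem_neumannDom {f : X → ℝ} : f ∈ G.neumannDom m ↔ MemLp f 2 m ∧ G.FinEnergy f := by
  rw [neumannDom, mem_ofPred_eq, G.energy_lt_top_iff]

variable {G m}

theorem comp_mem_neumannDom [FullAtoms m] {f : X → ℝ} (hf : f ∈ G.neumannDom m) {C : ℝ → ℝ}
    (hC : LipschitzWith 1 C) (hC0 : C 0 = 0) : (fun x => C (f x)) ∈ G.neumannDom m := by
  rw [mem_neumannDom] at hf ⊢
  exact ⟨memLp_comp hf.1 hC hC0, hf.2.comp hC hC0⟩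

theorem add_mem_neumannDom {f g : X → ℝ} (hf : f ∈ G.neumannDom m) (hg : g ∈ G.neumannDom m) :
    f + g ∈ G.neumannDom m := by
  rw [mem_neumannDom] at hf hg ⊢
  exact ⟨hf.1.add hg.1, hf.2.add hg.2⟩

theorem smul_mem_neumannDom {f : X → ℝ} (hf : f ∈ G.neumannDom m) (a : ℝ) :
    a • f ∈ G.neumannDom m := by
  rw [mem_neumannDom] at hf ⊢
  exact ⟨hf.1.const_smul a, hf.2.smul a⟩

theorem mul_mem_bddDom {f g : X → ℝ} (hf : f ∈ G.bddDom m) (hg : g ∈ G.bddDom m) :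
    f * g ∈ G.bddDom m := by
  obtain ⟨hf, K, hK⟩ := hf
  obtain ⟨hg, K', hK'⟩ := hg
  rw [mem_neumannDom] at hf hg
  refine ⟨(G.mem_neumannDom m).2 ⟨?_, hf.2.mul hg.2 hK hK'⟩, K * K', fun x => ?_⟩
  · refine (hg.1.const_smul K).of_le (hf.1.1.mul hg.1.1) (Eventually.of_forall fun x => ?_)
    simp only [Pi.mul_apply, Pi.smul_apply, smul_eq_mul, norm_mul, Real.norm_eq_abs]
    exact mul_le_mul_of_nonneg_right ((hK x).trans (le_abs_self K)) (abs_nonneg _)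
  · rw [Pi.mul_apply, abs_mul]
    exact mul_le_mul (hK x) (hK' x) (abs_nonneg _) ((abs_nonneg _).trans (hK x))

variable [FullAtoms m]

variable (G m)

theorem neumannForm_isForm : (G.neumannForm m).IsForm where
  zero_mem := by
    change ((0 : Lp ℝ 2 m) : X → ℝ) ∈ G.neumannDom m
    rw [coe_zero, mem_neumannDom]
    exact ⟨MemLp.zero, summable_zero.congr fun i => by rcases i with p | x <;> simp [grad]⟩
  add_mem f hf g hg := by
    change ((f + g : Lp ℝ 2 m) : X → ℝ) ∈ G.neumannDom m
    rw [coe_add]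
    exact add_mem_neumannDom hf hg
  smul_mem a f hf := by
    change ((a • f : Lp ℝ 2 m) : X → ℝ) ∈ G.neumannDom m
    rw [coe_smul]
    exact smul_mem_neumannDom hf a
  symm f hf g hg :=
    ((G.mem_neumannDom m).1 hf).2.energyBilin_comm ((G.mem_neumannDom m).1 hg).2
  linear f hf g hg h hh a b := by
    simp only [neumannForm, coe_add, coe_smul]
    exact ((G.mem_neumannDom m).1 hf).2.energyBilin_linear ((G.mem_neumannDom m).1 hg).2
      ((G.mem_neumannDom m).1 hh).2 a b
  nonneg f hf := ((G.mem_neumannDom m).1 hf).2.energyBilin_self_nonneg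

/-- A form-Cauchy sequence converges in ℓ², hence pointwise. Lower semicontinuity of the energy,
applied to u n - u k as k → ∞ with n fixed, bounds the energy of u n - f by the Cauchy tolerance. -/
theorem neumannForm_closed : (G.neumannForm m).Closed := by
  intro u hu hC
  set hQ := G.neumannForm_isForm m
  have hnn : ∀ f ∈ (G.neumannForm m).dom, 0 ≤ (G.neumannForm m).val f f := hQ.nonneg
  have hsub : ∀ f ∈ (G.neumannForm m).dom, ∀ g ∈ (G.neumannForm m).dom,
      f - g ∈ (G.neumannForm m).dom := fun f hf g hg => hQ.submodule.sub_mem hf hg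
  have hcau : CauchySeq u := by
    refine Metric.cauchySeq_iff.2 fun ε hε => ?_
    obtain ⟨N, hN⟩ := hC (ε ^ 2) (by positivity)
    refine ⟨N, fun n hn k hk => ?_⟩
    have h1 := hN n hn k hk
    rw [HForm.normSq] at h1
    rw [dist_eq_norm]
    refine lt_of_pow_lt_pow_left₀ 2 hε.le ?_
    linarith [hnn _ (hsub _ (hu n) _ (hu k))]
  obtain ⟨f, hf⟩ := cauchySeq_tendsto_of_complete hcau
  have hpt : ∀ x, Tendsto (fun n => (u n : X → ℝ) x) atTop (𝓝 (f x)) := fun x =>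
    ((continuous_eval x).tendsto f).comp hf
  have hen : ∀ ε : ℝ, 0 < ε → ∃ N, ∀ n ≥ N, G.energy ((u n - f : Lp ℝ 2 m) : X → ℝ) ≤
      ENNReal.ofReal ε := by
    intro ε hε
    obtain ⟨N, hN⟩ := hC ε hε
    refine ⟨N, fun n hn => ?_⟩
    refine energy_le_of_tendsto (u := fun k => ((u n - u k : Lp ℝ 2 m) : X → ℝ)) (fun x => ?_) ?_
    · simp only [coe_sub, Pi.sub_apply]
      exact tendsto_const_nhds.sub (hpt x)
    · filter_upwards [eventually_ge_atTop N] with k hk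
      rw [((G.mem_neumannDom m).1 (hsub _ (hu n) _ (hu k))).2.energy_eq]
      refine ENNReal.ofReal_le_ofReal ?_
      have h1 := hN n hn k hk
      rw [HForm.normSq] at h1
      have h2 : (G.neumannForm m).val (u n - u k) (u n - u k) < ε := by
        linarith [sq_nonneg ‖u n - u k‖]
      exact h2.le
  have hmem : ∃ N, ∀ n ≥ N, u n - f ∈ (G.neumannForm m).dom := by
    obtain ⟨N, hN⟩ := hen 1 one_pos
    exact ⟨N, fun n hn => ⟨Lp.memLp _, (hN n hn).trans_lt ENNReal.ofReal_lt_top⟩⟩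
  obtain ⟨N₀, hN₀⟩ := hmem
  refine ⟨f, ?_, ?_⟩
  · have := hsub _ (hu N₀) _ (hN₀ N₀ le_rfl)
    simpa using this
  · have h1 : Tendsto (fun n => ‖u n - f‖ ^ 2) atTop (𝓝 0) := by
      simpa using (tendsto_iff_norm_sub_tendsto_zero.1 hf).pow 2
    have h2 : Tendsto (fun n => (G.neumannForm m).val (u n - f) (u n - f)) atTop (𝓝 0) := by
      refine Metric.tendsto_atTop.2 fun ε hε => ?_
      obtain ⟨N, hN⟩ := hen (ε / 2) (by positivity)
      refine ⟨max N N₀, fun n hn => ?_⟩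
      have hd := hN₀ n (le_of_max_le_right hn)
      have h3 := hN n (le_of_max_le_left hn)
      rw [((G.mem_neumannDom m).1 hd).2.energy_eq, ENNReal.ofReal_le_ofReal_iff (by positivity)]
        at h3
      rw [Real.dist_eq, sub_zero, abs_of_nonneg (hnn _ hd)]
      exact lt_of_le_of_lt h3 (by linarith)
    simpa [HForm.normSq] using h2.add h1

theorem delta_mem_neumannForm (x : X) : delta m x ∈ (G.neumannForm m).dom := by
  classical
  exact ⟨Lp.memLp _, by rw [coe_delta]; exact G.energy_single_lt_top x⟩

/-! ## The Hilbert space of the Neumann form -/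

/-- The domain of the Neumann form as a Hilbert space. -/
abbrev NSpace : Type _ := (G.neumannForm_isForm m).Space

instance : CompleteSpace (G.NSpace m) :=
  (G.neumannForm_isForm m).completeSpace (G.neumannForm_closed m)

/-- An element of the Neumann space as an element of `ℓ²(X, m)`. -/
abbrev toL2 : G.NSpace m →ₗ[ℝ] Lp ℝ 2 m := (G.neumannForm_isForm m).toH

/-- An element of the Neumann space as a function. -/
def fn : G.NSpace m →ₗ[ℝ] (X → ℝ) where
  toFun F := G.toL2 m F
  map_add' F F' := by rw [map_add, coe_add]
  map_smul' a F := by rw [map_smul, coe_smul, RingHom.id_apply]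

theorem fn_apply (F : G.NSpace m) : G.fn m F = G.toL2 m F := rfl

theorem fn_mem (F : G.NSpace m) : G.fn m F ∈ G.neumannDom m :=
  (G.neumannForm_isForm m).toH_mem F

theorem fn_finEnergy (F : G.NSpace m) : G.FinEnergy (G.fn m F) :=
  ((G.mem_neumannDom m).1 (G.fn_mem m F)).2

theorem fn_injective : Function.Injective (G.fn m) := fun F F' h =>
  (G.neumannForm_isForm m).toH_injective (by
    ext1
    exact Eventually.of_forall fun x => congrFun h x)

variable {G m}

/-- An element of the Neumann domain as an element of the Neumann space. -/
def toN {f : X → ℝ} (hf : f ∈ G.neumannDom m) : G.NSpace m :=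
  (G.neumannForm_isForm m).ofDom (hf.1.toLp f) (by
    change (hf.1.toLp f : X → ℝ) ∈ G.neumannDom m
    rwa [coe_toLp])

@[simp]
theorem fn_toN {f : X → ℝ} (hf : f ∈ G.neumannDom m) : G.fn m (toN hf) = f := by
  rw [fn_apply, toN, HForm.IsForm.toH_ofDom, coe_toLp]

variable (G m)

theorem NSpace.norm_sq_eq (F : G.NSpace m) :
    ‖F‖ ^ 2 = G.energyBilin (G.fn m F) (G.fn m F) + ‖G.toL2 m F‖ ^ 2 :=
  (G.neumannForm_isForm m).norm_sq_eq F

theorem continuous_toL2 : Continuous (G.toL2 m) :=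
  ((G.toL2 m).mkContinuous 1 fun F => by
    simpa using (G.neumannForm_isForm m).norm_toH_le F).continuous

theorem continuous_fn_apply (x : X) : Continuous fun F : G.NSpace m => G.fn m F x :=
  (continuous_eval x).comp (G.continuous_toL2 m)

variable {G m}

/-- Applied at the base point of a harmonic measure, this bound turns norms in the Neumann space
into bounds for integrals over ∂X. -/
theorem abs_fn_apply_le (F : G.NSpace m) (x : X) :
    |G.fn m F x| ≤ (√(m.real {x}))⁻¹ * ‖F‖ := by
  have h1 := norm_sq_apply_le (G.toL2 m F) x
  have h2 := (G.neumannForm_isForm m).norm_toH_le F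
  have hp := Real.sqrt_pos.2 (real_pos m x)
  rw [inv_mul_eq_div, le_div_iff₀ hp]
  refine le_of_sq_le_sq ?_ (norm_nonneg F)
  rw [mul_pow, sq_abs, Real.sq_sqrt (real_pos m x).le, mul_comm]
  exact h1.trans (pow_le_pow_left₀ (norm_nonneg _) h2 2)

/-- The composition with a normal contraction. -/
def contract {C : ℝ → ℝ} (hC : LipschitzWith 1 C) (hC0 : C 0 = 0) (F : G.NSpace m) : G.NSpace m :=
  toN (comp_mem_neumannDom (G.fn_mem m F) hC hC0)

@[simp]
theorem fn_contract {C : ℝ → ℝ} (hC : LipschitzWith 1 C) (hC0 : C 0 = 0) (F : G.NSpace m) :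
    G.fn m (contract hC hC0 F) = fun x => C (G.fn m F x) := fn_toN _

theorem norm_contract_le {C : ℝ → ℝ} (hC : LipschitzWith 1 C) (hC0 : C 0 = 0) (F : G.NSpace m) :
    ‖contract hC hC0 F‖ ≤ ‖F‖ := by
  refine le_of_sq_le_sq ?_ (norm_nonneg F)
  rw [NSpace.norm_sq_eq, NSpace.norm_sq_eq, fn_contract]
  refine add_le_add ((G.fn_finEnergy m F).energyBilin_comp_le hC hC0) ?_
  have h : G.toL2 m (contract hC hC0 F) = hC.compLp hC0 (G.toL2 m F) := by
    ext1
    refine Eventually.of_forall fun x => ?_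
    rw [coe_compLp]
    exact congrFun (fn_contract hC hC0 F) x
  rw [h]
  refine pow_le_pow_left₀ (norm_nonneg _) ?_ 2
  simpa using hC.norm_compLp_le hC0 (G.toL2 m F)

end WGraph

/-- A bounded sequence in a Hilbert space that converges against a total set converges weakly. -/
theorem tendsto_inner_of_dense_span {E : Type*} [NormedAddCommGroup E] [InnerProductSpace ℝ E]
    {s : Set E} (hs : Dense (Submodule.span ℝ s : Set E)) {u : ℕ → E} {f : E} {K : ℝ}
    (hK : ∀ n, ‖u n‖ ≤ K)
    (h : ∀ k ∈ s, Tendsto (fun n => inner ℝ (u n) k) atTop (𝓝 (inner ℝ f k))) (w : E) :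
    Tendsto (fun n => inner ℝ (u n) w) atTop (𝓝 (inner ℝ f w)) := by
  have hspan : ∀ v ∈ Submodule.span ℝ s,
      Tendsto (fun n => inner ℝ (u n) v) atTop (𝓝 (inner ℝ f v)) := by
    intro v hv
    induction hv using Submodule.span_induction with
    | mem k hk => exact h k hk
    | zero => simp
    | add a b _ _ ha hb => simpa only [inner_add_right] using ha.add hb
    | smul c a _ ha => simpa only [real_inner_smul_right] using ha.const_mul c
  have hK0 : 0 ≤ K := (norm_nonneg _).trans (hK 0)
  refine Metric.tendsto_atTop.2 fun ε hε => ?_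
  have hM : 0 < K + ‖f‖ + 1 := by positivity
  obtain ⟨v, hv, hvw⟩ := Metric.mem_closure_iff.1 (hs w) (ε / (2 * (K + ‖f‖ + 1))) (by positivity)
  obtain ⟨N, hN⟩ := Metric.tendsto_atTop.1 (hspan v hv) (ε / 2) (by positivity)
  refine ⟨N, fun n hn => ?_⟩
  have h1 := hN n hn
  rw [Real.dist_eq, ← inner_sub_left] at h1 ⊢
  have h2 : inner ℝ (u n - f) w = inner ℝ (u n - f) v + inner ℝ (u n - f) (w - v) := by
    rw [← inner_add_right, add_sub_cancel]
  have h3 : |inner ℝ (u n - f) (w - v)| ≤ (K + ‖f‖ + 1) * ‖w - v‖ :=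
    (abs_real_inner_le_norm _ _).trans (mul_le_mul_of_nonneg_right
      (by linarith [norm_sub_le (u n) f, hK n]) (norm_nonneg _))
  rw [dist_eq_norm, lt_div_iff₀ (by positivity)] at hvw
  rw [h2]
  have h4 := abs_add_le (inner ℝ (u n - f) v) (inner ℝ (u n - f) (w - v))
  linarith

/-! ## The Dirichlet space -/

namespace WGraph

open FullAtoms

variable {X : Type*} [Countable X] [MeasurableSpace X] [DiscreteMeasurableSpace X]
  (G : WGraph X) (m : Measure X) [FullAtoms m]

/-- The indicator function of a point as an element of the Neumann space. -/
def deltaN (x : X) : G.NSpace m :=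
  (G.neumannForm_isForm m).ofDom (delta m x) (G.delta_mem_neumannForm m x)

theorem fn_deltaN [DecidableEq X] (x : X) : G.fn m (G.deltaN m x) = Pi.single x 1 := by
  rw [fn_apply, deltaN, HForm.IsForm.toH_ofDom, coe_delta]

/-- Orthogonality to the finitely supported functions thereby becomes the equation ℒh + h = 0. -/
theorem inner_deltaN (x : X) (F : G.NSpace m) : inner ℝ (G.deltaN m x) F =
    m.real {x} * (G.lap m (G.fn m F) x + G.fn m F x) := by
  classical
  have h1 : inner ℝ (G.deltaN m x) F = G.energyBilin (Pi.single x 1) (G.fn m F) +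
      m.real {x} * G.fn m F x := by
    rw [HForm.IsForm.inner_def, deltaN, HForm.IsForm.toH_ofDom, inner_delta, ← coe_delta (m := m)]
    rfl
  rw [h1, energyBilin_single (G.fn_finEnergy m F), lap]
  have := (real_pos m x).ne'
  field_simp

/-- The finitely supported functions. -/
def finSpace : Submodule ℝ (G.NSpace m) := Submodule.span ℝ (range (G.deltaN m))

/-- The closure of the finitely supported functions. -/
def DSpace : Submodule ℝ (G.NSpace m) := (G.finSpace m).topologicalClosure

theorem isClosed_DSpace : IsClosed (G.DSpace m : Set (G.NSpace m)) :=
  Submodule.isClosed_topologicalClosure _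

instance : CompleteSpace (G.DSpace m) := (G.isClosed_DSpace m).completeSpace_coe

theorem finSpace_le_DSpace : G.finSpace m ≤ G.DSpace m := Submodule.le_topologicalClosure _

theorem deltaN_mem_DSpace (x : X) : G.deltaN m x ∈ G.DSpace m :=
  G.finSpace_le_DSpace m (Submodule.subset_span ⟨x, rfl⟩)

variable {m}

theorem exists_mem_finSpace {φ : X → ℝ} (hφ : φ.support.Finite) :
    ∃ F ∈ G.finSpace m, G.fn m F = φ := by
  classical
  refine ⟨∑ x ∈ hφ.toFinset, φ x • G.deltaN m x, Submodule.sum_mem _ fun x _ =>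
    Submodule.smul_mem _ _ (Submodule.subset_span ⟨x, rfl⟩), ?_⟩
  rw [map_sum]
  ext y
  simp only [map_smul, fn_deltaN, Finset.sum_apply, Pi.smul_apply, smul_eq_mul, Pi.single_apply,
    mul_ite, mul_one, mul_zero, Finset.sum_ite_eq, Finite.mem_toFinset, Function.mem_support]
  by_cases hy : φ y = 0 <;> simp [hy]

variable {G}

theorem mem_finSpace_iff {F : G.NSpace m} :
    F ∈ G.finSpace m ↔ (G.fn m F).support.Finite := by
  classical
  constructor
  · intro hF
    induction hF using Submodule.span_induction with
    | mem k hk =>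
      obtain ⟨x, rfl⟩ := hk
      rw [fn_deltaN]
      exact (finite_singleton x).subset (Pi.support_single_subset)
    | zero => simp
    | add a b _ _ ha hb =>
      rw [map_add]
      exact (ha.union hb).subset (Function.support_add _ _)
    | smul c a _ ha =>
      rw [map_smul]
      exact ha.subset (Function.support_const_smul_subset c _)
  · intro hF
    obtain ⟨F', hF', h⟩ := G.exists_mem_finSpace (m := m) hF
    rwa [← G.fn_injective m h]

theorem energy_add_eLpNorm (F : G.NSpace m) :
    G.energy (G.fn m F) + eLpNorm (G.fn m F) 2 m ^ 2 = ENNReal.ofReal (‖F‖ ^ 2) := by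
  rw [NSpace.norm_sq_eq, ENNReal.ofReal_add (G.fn_finEnergy m F).energyBilin_self_nonneg
    (sq_nonneg _), (G.fn_finEnergy m F).energy_eq, ENNReal.ofReal_pow (norm_nonneg _),
    ofReal_norm, Lp.enorm_def]
  rfl

theorem fn_mem_dirichletDom_iff {F : G.NSpace m} :
    G.fn m F ∈ G.dirichletDom m ↔ F ∈ G.DSpace m := by
  have key : F ∈ G.DSpace m ↔ ∀ ε > 0, ∃ b ∈ G.finSpace m, dist F b < ε :=
    Metric.mem_closure_iff
  have hn : ∀ b : G.NSpace m, G.energy (G.fn m F - G.fn m b) +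
      eLpNorm (G.fn m F - G.fn m b) 2 m ^ 2 = ENNReal.ofReal (dist F b ^ 2) := fun b => by
    rw [← map_sub, energy_add_eLpNorm, dist_eq_norm]
  rw [key]
  constructor
  · rintro ⟨-, h⟩ ε hε
    obtain ⟨φ, hφ, hlt⟩ := h (ENNReal.ofReal (ε ^ 2)) (ENNReal.ofReal_pos.2 (by positivity))
    obtain ⟨b, hb, rfl⟩ := G.exists_mem_finSpace (m := m) hφ
    rw [hn, ENNReal.ofReal_lt_ofReal_iff (by positivity)] at hlt
    exact ⟨b, hb, lt_of_pow_lt_pow_left₀ 2 hε.le hlt⟩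
  · refine fun h => ⟨G.fn_mem m F, fun ε hε => ?_⟩
    by_cases hε' : ε = ∞
    · obtain ⟨b, hb, -⟩ := h 1 one_pos
      refine ⟨G.fn m b, mem_finSpace_iff.1 hb, ?_⟩
      rw [hn, hε']
      exact ENNReal.ofReal_lt_top
    · obtain ⟨b, hb, hlt⟩ := h (√ε.toReal) (Real.sqrt_pos.2 (ENNReal.toReal_pos hε.ne' hε'))
      refine ⟨G.fn m b, mem_finSpace_iff.1 hb, ?_⟩
      rw [hn, ENNReal.ofReal_lt_iff_lt_toReal (sq_nonneg _) hε', ← Real.sq_sqrt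
        ENNReal.toReal_nonneg]
      exact pow_lt_pow_left₀ hlt dist_nonneg two_ne_zero

theorem mem_dirichletDom_iff {f : X → ℝ} :
    f ∈ G.dirichletDom m ↔ ∃ F ∈ G.DSpace m, G.fn m F = f := by
  constructor
  · intro h
    refine ⟨toN h.1, fn_mem_dirichletDom_iff.1 ?_, fn_toN h.1⟩
    rwa [fn_toN]
  · rintro ⟨F, hF, rfl⟩
    exact fn_mem_dirichletDom_iff.2 hF

/-- A vector orthogonal to the Riesz representatives of all point evaluations is a function that
vanishes everywhere. With `tendsto_inner_of_dense_span`, norm bounded pointwise convergence thus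
becomes weak convergence. -/
theorem dense_span_evalRepr : Dense (Submodule.span ℝ {k : G.NSpace m |
    ∃ x, ∀ F, inner ℝ F k = G.fn m F x} : Set (G.NSpace m)) := by
  rw [Submodule.dense_iff_topologicalClosure_eq_top, Submodule.topologicalClosure_eq_top_iff,
    Submodule.eq_bot_iff]
  intro F hF
  refine G.fn_injective m ?_
  ext x
  let l : G.NSpace m →L[ℝ] ℝ := ⟨(LinearMap.proj x).comp (G.fn m), G.continuous_fn_apply m x⟩
  have hl : ∀ F', inner ℝ F' ((InnerProductSpace.toDual ℝ _).symm l) = G.fn m F' x := fun F' => by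
    rw [real_inner_comm, InnerProductSpace.toDual_symm_apply]
    rfl
  have h := (Submodule.mem_orthogonal' _ _).1 hF _ (Submodule.subset_span ⟨x, hl⟩)
  rw [hl] at h
  simpa using h

/-- Bounded pointwise limits of elements of the Dirichlet space belong to the Dirichlet space. -/
theorem mem_DSpace_of_tendsto {U : ℕ → G.NSpace m} {F : G.NSpace m} {K : ℝ}
    (hU : ∀ n, U n ∈ G.DSpace m) (hK : ∀ n, ‖U n‖ ≤ K)
    (h : ∀ x, Tendsto (fun n => G.fn m (U n) x) atTop (𝓝 (G.fn m F x))) : F ∈ G.DSpace m := by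
  -- A closed subspace equals its double orthogonal complement, so weak limits may be tested against
  -- w orthogonal to it.
  rw [← Submodule.orthogonal_orthogonal (G.DSpace m), Submodule.mem_orthogonal']
  intro w hw
  have h1 := tendsto_inner_of_dense_span dense_span_evalRepr hK (f := F) (fun k ⟨x, hk⟩ => by
    simpa only [hk] using h x) w
  refine tendsto_nhds_unique h1 ?_
  simp only [(Submodule.mem_orthogonal _ _).1 hw _ (hU _)]
  exact tendsto_const_nhds

theorem exists_seq_finSpace {F : G.NSpace m} (hF : F ∈ G.DSpace m) :
    ∃ (φ : ℕ → G.NSpace m) (K : ℝ), (∀ n, φ n ∈ G.finSpace m) ∧ (∀ n, ‖φ n‖ ≤ K) ∧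
      ∀ x, Tendsto (fun n => G.fn m (φ n) x) atTop (𝓝 (G.fn m F x)) := by
  obtain ⟨φ, hφ, hlim⟩ := mem_closure_iff_seq_limit.1 hF
  obtain ⟨K, hK⟩ := (Metric.isBounded_range_of_tendsto φ hlim).exists_norm_le
  exact ⟨φ, K, hφ, fun n => hK _ ⟨n, rfl⟩, fun x =>
    ((G.continuous_fn_apply m x).tendsto F).comp hlim⟩

/-- C preserves finite supports since C(0) = 0, and it does not increase norms, so the images of an
approximating sequence are bounded and converge pointwise. Norm continuity of f ↦ C ∘ f is not
needed. -/
theorem contract_mem_DSpace {C : ℝ → ℝ} (hC : LipschitzWith 1 C) (hC0 : C 0 = 0)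
    {F : G.NSpace m} (hF : F ∈ G.DSpace m) : contract hC hC0 F ∈ G.DSpace m := by
  obtain ⟨φ, K, hφ, hK, hlim⟩ := exists_seq_finSpace hF
  refine mem_DSpace_of_tendsto (U := fun n => contract hC hC0 (φ n)) (fun n => ?_)
    (fun n => (norm_contract_le hC hC0 _).trans (hK n)) fun x => ?_
  · refine G.finSpace_le_DSpace m (mem_finSpace_iff.2 ((mem_finSpace_iff.1 (hφ n)).subset ?_))
    intro x hx h0
    exact hx (by simp only [fn_contract, h0, hC0])
  · simp only [fn_contract]
    exact (hC.continuous.tendsto _).comp (hlim x)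

theorem lipschitzWith_abs : LipschitzWith 1 fun t : ℝ => |t| :=
  LipschitzWith.of_dist_le_mul fun s t => by
    simpa [Real.dist_eq] using abs_abs_sub_abs_le s t

/-- The absolute value of an element of the Neumann space. -/
def absN (F : G.NSpace m) : G.NSpace m := contract lipschitzWith_abs abs_zero F

@[simp]
theorem fn_absN (F : G.NSpace m) : G.fn m (absN F) = fun x => |G.fn m F x| :=
  fn_contract lipschitzWith_abs abs_zero F

theorem norm_absN_le (F : G.NSpace m) : ‖absN F‖ ≤ ‖F‖ :=
  norm_contract_le lipschitzWith_abs abs_zero F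

/-- The Dirichlet space is an order ideal of the Neumann space. -/
theorem mem_DSpace_of_abs_le {F W : G.NSpace m} (hW : W ∈ G.DSpace m)
    (h : ∀ x, |G.fn m F x| ≤ G.fn m W x) : F ∈ G.DSpace m := by
  obtain ⟨φ, K, hφ, hK, hlim⟩ := exists_seq_finSpace hW
  -- The function (|F + φ| - |F - φ|)/2 vanishes where φ does, and replacing φ by its limit W gives
  -- F because |F| ≤ W.
  refine mem_DSpace_of_tendsto (K := ‖F‖ + K)
    (U := fun n => (1 / 2 : ℝ) • (absN (F + φ n) - absN (F - φ n))) (fun n => ?_)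
    (fun n => ?_) fun x => ?_
  · refine G.finSpace_le_DSpace m (mem_finSpace_iff.2 ((mem_finSpace_iff.1 (hφ n)).subset ?_))
    intro x hx h0
    exact hx (by simp [h0])
  · rw [norm_smul]
    have h1 := norm_sub_le (absN (F + φ n)) (absN (F - φ n))
    have h2 := (norm_absN_le (F + φ n)).trans (norm_add_le _ _)
    have h3 := (norm_absN_le (F - φ n)).trans (norm_sub_le _ _)
    have h4 := hK n
    norm_num
    linarith
  · have h1 : G.fn m F x = 1 / 2 *
        (|G.fn m F x + G.fn m W x| - |G.fn m F x - G.fn m W x|) := by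
      obtain ⟨h2, h3⟩ := abs_le.1 (h x)
      rw [abs_of_nonneg (by linarith), abs_of_nonpos (by linarith)]
      ring
    rw [h1]
    simp only [map_smul, map_sub, fn_absN, map_add, Pi.smul_apply, Pi.sub_apply, Pi.add_apply,
      smul_eq_mul]
    exact ((tendsto_const_nhds.add (hlim x)).abs.sub (tendsto_const_nhds.sub (hlim x)).abs).const_mul _

/-! ### Harmonic functions -/

theorem lap_add_eq_zero_of_mem_orthogonal {F : G.NSpace m} (hF : F ∈ (G.DSpace m)ᗮ) (x : X) :
    G.lap m (G.fn m F) x + G.fn m F x = 0 := by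
  have h := (Submodule.mem_orthogonal _ _).1 hF _ (G.deltaN_mem_DSpace m x)
  rw [inner_deltaN] at h
  exact (mul_eq_zero.1 h).resolve_left (real_pos m x).ne'

/-- The negative part N of H satisfies N ≤ |P| because P + H ≥ 0, so it lies in the Dirichlet space
and is orthogonal to H. Then |H| = H + 2N has squared norm ‖H‖² + 4‖N‖², while taking absolute
values does not increase the norm; hence N = 0. -/
theorem fn_nonneg_of_mem_orthogonal {P H : G.NSpace m} (hP : P ∈ G.DSpace m)
    (hH : H ∈ (G.DSpace m)ᗮ) (h : ∀ x, 0 ≤ G.fn m (P + H) x) (x : X) : 0 ≤ G.fn m H x := by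
  set N : G.NSpace m := (1 / 2 : ℝ) • (absN H - H) with hN
  have hNx : ∀ y, G.fn m N y = 1 / 2 * (|G.fn m H y| - G.fn m H y) := fun y => by simp [hN]
  have hND : N ∈ G.DSpace m := by
    refine mem_DSpace_of_abs_le (W := absN P) (contract_mem_DSpace _ _ hP) fun y => ?_
    rw [hNx, fn_absN]
    have h1 := h y
    rw [map_add, Pi.add_apply] at h1
    rcases le_total 0 (G.fn m H y) with h2 | h2
    · rw [abs_of_nonneg h2]
      simp
    · rw [abs_of_nonpos h2, abs_of_nonneg (by linarith)]
      linarith [le_abs_self (G.fn m P y)]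
  have h0 : inner ℝ H N = 0 := (Submodule.mem_orthogonal' _ _).1 hH _ hND
  have habs : absN H = H + (2 : ℝ) • N := by
    rw [hN, smul_smul]
    norm_num
  have h1 := norm_absN_le H
  have h2 : ‖absN H‖ ^ 2 = ‖H‖ ^ 2 + 4 * ‖N‖ ^ 2 := by
    rw [habs, norm_add_sq_real, real_inner_smul_right, h0, norm_smul]
    norm_num
    ring
  have h3 : ‖N‖ = 0 := by
    have := pow_le_pow_left₀ (norm_nonneg _) h1 2
    rw [← sq_eq_zero_iff]
    nlinarith [sq_nonneg ‖N‖]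
  have h4 := hNx x
  rw [norm_eq_zero.1 h3, map_zero, Pi.zero_apply] at h4
  have : |G.fn m H x| = G.fn m H x := by linarith
  rw [← this]
  exact abs_nonneg _

/-- A nonnegative harmonic function on a connected graph that vanishes at a point is zero. -/
theorem eq_zero_of_connected (hG : G.Connected) {h : X → ℝ} (hf : G.FinEnergy h)
    (h0 : ∀ x, 0 ≤ h x) (hh : ∀ x, G.lap m h x + h x = 0) {o : X} (ho : h o = 0) : h = 0 := by
  -- At a zero x of h the equation reduces to Σ_y b(x, y) h(y) = 0 with nonnegative terms, so h
  -- vanishes at the neighbours of x.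
  have step : ∀ x y, h x = 0 → 0 < G.b x y → h y = 0 := by
    intro x y hx hxy
    have h1 := hh x
    have hs := hf.summable_edge x
    rw [lap, hx, mul_zero, add_zero, add_zero] at h1
    have h2 : ∑' y, G.b x y * h y = 0 := by
      have h3 := (mul_eq_zero.1 h1).resolve_left (one_div_ne_zero (real_pos m x).ne')
      rw [← neg_eq_zero, ← tsum_neg, ← h3]
      exact tsum_congr fun z => by ring
    have hs' : Summable fun y => G.b x y * h y := by
      refine hs.neg.congr fun z => ?_
      rw [hx]
      ring
    have h4 := (hasSum_zero_iff_of_nonneg fun z => mul_nonneg (G.b_nonneg x z) (h0 z)).1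
      (h2 ▸ hs'.hasSum)
    exact (mul_eq_zero.1 (congrFun h4 y)).resolve_left hxy.ne'
  ext x
  induction hG o x with
  | refl => exact ho
  | tail _ hxy ih => exact step _ _ ih hxy

end WGraph

/-! ### Absolute values of extended reals and truncations of the real line. -/

theorem EReal.abs_eq_max_toENNReal (x : EReal) : x.abs = max x.toENNReal (-x).toENNReal := by
  induction x with
  | bot => simp
  | coe r =>
    rw [EReal.abs_def, ← EReal.coe_neg, EReal.toENNReal_of_ne_top (EReal.coe_ne_top _),
      EReal.toENNReal_of_ne_top (EReal.coe_ne_top _), EReal.toReal_coe, EReal.toReal_coe,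
      ← ENNReal.ofReal_max]
    rfl
  | top => simp

theorem EReal.continuous_abs : Continuous EReal.abs := by
  have h : EReal.abs = fun x : EReal => max x.toENNReal (-x).toENNReal :=
    funext EReal.abs_eq_max_toENNReal
  rw [h]
  exact EReal.continuous_toENNReal.max (EReal.continuous_toENNReal.comp continuous_neg)

theorem EReal.coe_toReal_of_abs_ne_top {x : EReal} (h : x.abs ≠ ∞) : (x.toReal : EReal) = x := by
  refine EReal.coe_toReal ?_ ?_ <;> rintro rfl <;> simp at h

theorem EReal.ofReal_abs_toReal_of_abs_ne_top {x : EReal} (h : x.abs ≠ ∞) :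
    ENNReal.ofReal |x.toReal| = x.abs := by
  rw [← EReal.abs_def, EReal.coe_toReal_of_abs_ne_top h]

theorem lipschitzWith_clamp (K : ℝ) : LipschitzWith 1 fun t : ℝ => max (-K) (min K t) := by
  refine LipschitzWith.of_le_add fun s t => ?_
  rw [Real.dist_eq]
  rcases max_cases (-K) (min K s) with h1 | h1 <;> rcases max_cases (-K) (min K t) with h2 | h2 <;>
  rcases min_cases K s with h3 | h3 <;> rcases min_cases K t with h4 | h4 <;>
  linarith [le_abs_self (s - t), abs_nonneg (s - t)]

theorem clamp_zero {K : ℝ} (hK : 0 ≤ K) : max (-K) (min K 0) = 0 := by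
  rw [min_eq_right hK, max_eq_right (by linarith)]

theorem abs_clamp_le {K : ℝ} (hK : 0 ≤ K) (t : ℝ) : |max (-K) (min K t)| ≤ K :=
  abs_le.2 ⟨le_max_left _ _, max_le (by linarith) (min_le_left _ _)⟩

theorem clamp_eq_self {K t : ℝ} (h : |t| ≤ K) : max (-K) (min K t) = t := by
  rw [min_eq_right (abs_le.1 h).2, max_eq_right (abs_le.1 h).1]

/-- The soft thresholding function at height `ε`. -/
def softThreshold (ε t : ℝ) : ℝ := max (t - ε) 0 + min (t + ε) 0

theorem lipschitzWith_softThreshold {ε : ℝ} (hε : 0 ≤ ε) : LipschitzWith 1 (softThreshold ε) := by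
  refine LipschitzWith.of_le_add fun s t => ?_
  rw [Real.dist_eq]
  simp only [softThreshold]
  rcases max_cases (s - ε) 0 with h1 | h1 <;> rcases max_cases (t - ε) 0 with h2 | h2 <;>
  rcases min_cases (s + ε) 0 with h3 | h3 <;> rcases min_cases (t + ε) 0 with h4 | h4 <;>
  linarith [le_abs_self (s - t), abs_nonneg (s - t)]

theorem softThreshold_eq_zero {ε t : ℝ} (h : |t| ≤ ε) : softThreshold ε t = 0 := by
  obtain ⟨h1, h2⟩ := abs_le.1 h
  rw [softThreshold, max_eq_right (by linarith), min_eq_right (by linarith), add_zero]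

theorem abs_softThreshold_sub_le {ε : ℝ} (hε : 0 ≤ ε) (t : ℝ) : |softThreshold ε t - t| ≤ ε := by
  rw [softThreshold, abs_le]
  rcases max_cases (t - ε) 0 with h1 | h1 <;> rcases min_cases (t + ε) 0 with h3 | h3 <;>
  constructor <;> linarith

theorem abs_softThreshold_le {ε : ℝ} (hε : 0 ≤ ε) (t : ℝ) : |softThreshold ε t| ≤ |t| := by
  have h := (lipschitzWith_softThreshold hε).dist_le_mul t 0
  simpa [Real.dist_eq, softThreshold_eq_zero (abs_zero.trans_le hε)] using h

/-- These truncations vanish for |t| ≤ 1/(n + 1) and are bounded by n, so n times a nonnegative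
function that is at least 1 on {|f| ≥ 1/(n + 1)} dominates the truncated f. -/
theorem tendsto_clamp_softThreshold (t : ℝ) :
    Tendsto (fun n : ℕ => max (-(n : ℝ)) (min (n : ℝ) (softThreshold (1 / ((n : ℝ) + 1)) t))) atTop
      (𝓝 t) := by
  have hpos : ∀ n : ℕ, (0 : ℝ) ≤ 1 / ((n : ℝ) + 1) := fun n => by positivity
  have h1 : Tendsto (fun n : ℕ => softThreshold (1 / ((n : ℝ) + 1)) t) atTop (𝓝 t) := by
    refine tendsto_iff_norm_sub_tendsto_zero.2 (squeeze_zero (fun n => norm_nonneg _)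
      (fun n => abs_softThreshold_sub_le (hpos n) t) tendsto_one_div_add_atTop_nhds_zero_nat)
  refine h1.congr' ?_
  filter_upwards [eventually_ge_atTop ⌈|t|⌉₊] with n hn
  exact (clamp_eq_self ((abs_softThreshold_le (hpos n) t).trans (Nat.ceil_le.1 hn))).symm

/-! ## Boundary values -/

namespace WGraph

open FullAtoms

variable {X : Type*} [Countable X] [MeasurableSpace X] [DiscreteMeasurableSpace X]
  (G : WGraph X) (m : Measure X)

/-- The trace on `X` of the neighbourhoods of a point of `X̂`. -/
def nhdsIn (p : G.Hat m) : Filter X := comap (G.incl m) (𝓝 p)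

instance (p : G.Hat m) : (G.nhdsIn m p).NeBot :=
  comap_neBot fun t ht => by
    obtain ⟨_, hq, x, rfl⟩ := mem_closure_iff_nhds.1 (G.denseRange_incl m p) t ht
    exact ⟨x, hq⟩

variable {G m}

theorem tendsto_ext {f : X → ℝ} (hf : f ∈ G.neumannDom m) (p : G.Hat m) :
    Tendsto (fun x => (f x : EReal)) (G.nhdsIn m p) (𝓝 (G.ext m f p)) :=
  (((G.continuous_ext m hf).tendsto p).comp tendsto_comap).congr fun x => G.ext_incl m hf x

theorem tendsto_bddExt (f : G.bddDom m) (p : G.Hat m) :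
    Tendsto (f : X → ℝ) (G.nhdsIn m p) (𝓝 (G.bddExt m f p)) :=
  ((G.continuous_bddExt m f).tendsto p).comp tendsto_comap

variable (G m) in
/-- The absolute value of the extension of a function. -/
def absExt (f : X → ℝ) (p : G.Hat m) : ℝ≥0∞ := (G.ext m f p).abs

theorem continuous_absExt {f : X → ℝ} (hf : f ∈ G.neumannDom m) : Continuous (G.absExt m f) :=
  EReal.continuous_abs.comp (G.continuous_ext m hf)

theorem tendsto_absExt {f : X → ℝ} (hf : f ∈ G.neumannDom m) (p : G.Hat m) :
    Tendsto (fun x => ENNReal.ofReal |f x|) (G.nhdsIn m p) (𝓝 (G.absExt m f p)) :=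
  (EReal.continuous_abs.tendsto _).comp (tendsto_ext hf p)

theorem absExt_incl {f : X → ℝ} (hf : f ∈ G.neumannDom m) (x : X) :
    G.absExt m f (G.incl m x) = ENNReal.ofReal |f x| := by
  rw [absExt, G.ext_incl m hf, EReal.abs_def]

theorem absExt_eq_zero_iff {f : X → ℝ} {p : G.Hat m} :
    G.absExt m f p = 0 ↔ G.ext m f p = 0 := EReal.abs_eq_zero_iff

theorem tendsto_toReal_ext {f : X → ℝ} (hf : f ∈ G.neumannDom m) {p : G.Hat m}
    (h : G.absExt m f p ≠ ∞) : Tendsto f (G.nhdsIn m p) (𝓝 (G.ext m f p).toReal) := by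
  have h1 := tendsto_ext hf p
  rw [← EReal.coe_toReal_of_abs_ne_top h] at h1
  exact EReal.tendsto_coe.1 h1

theorem ext_eq_of_tendsto {f : X → ℝ} (hf : f ∈ G.neumannDom m) {p : G.Hat m} {a : ℝ}
    (h : Tendsto f (G.nhdsIn m p) (𝓝 a)) : G.ext m f p = a :=
  tendsto_nhds_unique (tendsto_ext hf p) (EReal.tendsto_coe.2 h)

theorem absExt_le_of_abs_le {f g : X → ℝ} (hf : f ∈ G.neumannDom m) (hg : g ∈ G.neumannDom m)
    (h : ∀ x, |f x| ≤ |g x|) (p : G.Hat m) : G.absExt m f p ≤ G.absExt m g p :=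
  le_of_tendsto_of_tendsto' (tendsto_absExt hf p) (tendsto_absExt hg p) fun x =>
    ENNReal.ofReal_le_ofReal (h x)

theorem absExt_add_le {f g : X → ℝ} (hf : f ∈ G.neumannDom m) (hg : g ∈ G.neumannDom m)
    (p : G.Hat m) : G.absExt m (f + g) p ≤ G.absExt m f p + G.absExt m g p :=
  le_of_tendsto_of_tendsto' (tendsto_absExt (add_mem_neumannDom hf hg) p)
    ((tendsto_absExt hf p).add (tendsto_absExt hg p)) fun x => by
      rw [← ENNReal.ofReal_add (abs_nonneg _) (abs_nonneg _)]
      exact ENNReal.ofReal_le_ofReal (abs_add_le _ _)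

theorem absExt_smul {f : X → ℝ} (hf : f ∈ G.neumannDom m) (a : ℝ) (p : G.Hat m) :
    G.absExt m (a • f) p = ENNReal.ofReal |a| * G.absExt m f p := by
  refine tendsto_nhds_unique (tendsto_absExt (smul_mem_neumannDom hf a) p) ?_
  refine (ENNReal.Tendsto.const_mul (tendsto_absExt hf p) (Or.inr ENNReal.ofReal_ne_top)).congr
    fun x => ?_
  rw [← ENNReal.ofReal_mul (abs_nonneg a), ← abs_mul]
  rfl

variable [FullAtoms m]

/-- The boundary is defined through bounded elements of the Dirichlet space; arctan F is one, and
tan carries its zero limit back to F. -/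
theorem trace_eq_zero_of_mem_DSpace {F : G.NSpace m} (hF : F ∈ G.DSpace m) (z : G.Bdry m) :
    G.trace m (G.fn m F) z = 0 := by
  have hA : G.fn m (contract lipschitzWith_arctan Real.arctan_zero F) ∈ G.dirichletDom m :=
    fn_mem_dirichletDom_iff.2 (contract_mem_DSpace _ _ hF)
  rw [fn_contract] at hA
  have h1 := tendsto_bddExt ⟨_, G.arctan_mem_bddDom m (G.fn_mem m F)⟩ z.1
  rw [z.2.2 _ hA] at h1
  have h2 : Tendsto (fun x => Real.tan (Real.arctan (G.fn m F x))) (G.nhdsIn m z.1) (𝓝 0) := by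
    have := (Real.continuousAt_tan.2 (by simp : Real.cos 0 ≠ 0)).tendsto.comp h1
    rwa [Real.tan_zero] at this
  simp only [Real.tan_arctan] at h2
  exact ext_eq_of_tendsto (G.fn_mem m F) h2

/-- The compact set {|f| ≥ ε} of X̂ contains no boundary point. A point of it in X is handled by its
indicator function; at any other point some bounded g in the Dirichlet domain is nonzero, and a
multiple of |g| is at least 1 nearby. Finitely many of these functions are added. -/
theorem exists_mem_DSpace_one_le {f : X → ℝ} (hf : f ∈ G.neumannDom m)
    (h : ∀ z, G.trace m f z = 0) {ε : ℝ} (hε : 0 < ε) :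
    ∃ W ∈ G.DSpace m, (∀ x, 0 ≤ G.fn m W x) ∧ ∀ x, ε ≤ |f x| → 1 ≤ G.fn m W x := by
  classical
  have hcpt : IsCompact {p : G.Hat m | ENNReal.ofReal ε ≤ G.absExt m f p} :=
    (isClosed_le continuous_const (continuous_absExt hf)).isCompact
  obtain ⟨W, hW, h0, h1⟩ := hcpt.induction_on
    (p := fun s => ∃ W ∈ G.DSpace m, (∀ x, 0 ≤ G.fn m W x) ∧
      ∀ x, G.incl m x ∈ s → 1 ≤ G.fn m W x)
    ⟨0, Submodule.zero_mem _, by simp, by simp⟩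
    (fun s t hst ⟨W, hW, h0, h1⟩ => ⟨W, hW, h0, fun x hx => h1 x (hst hx)⟩)
    (fun s t ⟨W, hW, h0, h1⟩ ⟨W', hW', h0', h1'⟩ => ⟨W + W', Submodule.add_mem _ hW hW',
      fun x => by
        rw [map_add]
        exact add_nonneg (h0 x) (h0' x),
      fun x hx => by
        rw [map_add, Pi.add_apply]
        rcases hx with hx | hx
        · linarith [h1 x hx, h0' x]
        · linarith [h1' x hx, h0 x]⟩)
    (fun p hp => by
      by_cases hpr : p ∈ range (G.incl m)
      · obtain ⟨x, rfl⟩ := hpr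
        refine ⟨{G.incl m x}, mem_nhdsWithin_of_mem_nhds
          ((G.isOpen_singleton_incl m lt_top x).mem_nhds rfl), G.deltaN m x,
          G.deltaN_mem_DSpace m x, fun y => ?_, fun y hy => ?_⟩
        · rw [fn_deltaN, Pi.single_apply]
          split_ifs <;> norm_num
        · rw [G.injective_incl m lt_top hy, fn_deltaN]
          simp
      · have : ∃ g : G.bddDom m, (g : X → ℝ) ∈ G.dirichletDom m ∧ G.bddExt m g p ≠ 0 := by
          by_contra! hcon
          have hz := h ⟨p, hpr, hcon⟩
          have hp' : ENNReal.ofReal ε ≤ G.absExt m f p := hp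
          rw [absExt_eq_zero_iff.2 hz, nonpos_iff_eq_zero, ENNReal.ofReal_eq_zero] at hp'
          linarith
        obtain ⟨g, hgD, hg⟩ := this
        obtain ⟨F, hF, hFg⟩ := mem_dirichletDom_iff.1 hgD
        have ha := abs_pos.2 hg
        set a := |G.bddExt m g p|
        refine ⟨{q | a / 2 < |G.bddExt m g q|}, mem_nhdsWithin_of_mem_nhds
          ((isOpen_lt continuous_const (G.continuous_bddExt m g).abs).mem_nhds
            (half_lt_self ha)), (2 / a) • absN F,
          Submodule.smul_mem _ _ (contract_mem_DSpace _ _ hF), fun y => ?_, fun y hy => ?_⟩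
        · rw [map_smul, fn_absN]
          exact mul_nonneg (by positivity) (abs_nonneg _)
        · have hy' : a / 2 < |G.bddExt m g (G.incl m y)| := hy
          rw [G.bddExt_incl] at hy'
          rw [map_smul, fn_absN, hFg, Pi.smul_apply, smul_eq_mul, div_mul_eq_mul_div, le_div_iff₀ ha]
          linarith)
  refine ⟨W, hW, h0, fun x hx => h1 x ?_⟩
  change ENNReal.ofReal ε ≤ G.absExt m f (G.incl m x)
  rw [absExt_incl hf]
  exact ENNReal.ofReal_le_ofReal hx

/-- The Dirichlet space consists of the functions in the Neumann space with zero boundary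
values. -/
theorem mem_DSpace_iff_trace_eq_zero {F : G.NSpace m} :
    F ∈ G.DSpace m ↔ ∀ z, G.trace m (G.fn m F) z = 0 := by
  refine ⟨trace_eq_zero_of_mem_DSpace, fun h => ?_⟩
  have hpos : ∀ n : ℕ, (0 : ℝ) < 1 / ((n : ℝ) + 1) := fun n => by positivity
  have hz : ∀ n : ℕ, softThreshold (1 / ((n : ℝ) + 1)) 0 = 0 := fun n =>
    softThreshold_eq_zero (abs_zero.trans_le (hpos n).le)
  -- The approximants are dominated by n W, with W from `exists_mem_DSpace_one_le` at height 1/(n +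
  -- 1), so the order ideal property applies.
  refine mem_DSpace_of_tendsto (K := ‖F‖) (U := fun n : ℕ => contract (lipschitzWith_clamp n)
    (clamp_zero n.cast_nonneg) (contract (lipschitzWith_softThreshold (hpos n).le) (hz n) F))
    (fun n => ?_) (fun n => (norm_contract_le _ _ _).trans (norm_contract_le _ _ _)) fun x => ?_
  · obtain ⟨W, hW, h0, h1⟩ := exists_mem_DSpace_one_le (G.fn_mem m F) h (hpos n)
    refine mem_DSpace_of_abs_le (W := (n : ℝ) • W) (Submodule.smul_mem _ _ hW) fun x => ?_
    simp only [fn_contract, map_smul, Pi.smul_apply, smul_eq_mul]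
    rcases le_total (1 / ((n : ℝ) + 1)) |G.fn m F x| with hx | hx
    · exact (abs_clamp_le n.cast_nonneg _).trans
        (le_mul_of_one_le_right n.cast_nonneg (h1 x hx))
    · rw [softThreshold_eq_zero hx, clamp_zero n.cast_nonneg, abs_zero]
      exact mul_nonneg n.cast_nonneg (h0 x)
  · simp only [fn_contract]
    exact tendsto_clamp_softThreshold _

theorem mem_dirichletDom_iff_trace {f : X → ℝ} :
    f ∈ G.dirichletDom m ↔ f ∈ G.neumannDom m ∧ ∀ z, G.trace m f z = 0 := by
  constructor
  · intro h
    obtain ⟨F, hF, rfl⟩ := mem_dirichletDom_iff.1 h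
    exact ⟨G.fn_mem m F, trace_eq_zero_of_mem_DSpace hF⟩
  · rintro ⟨hf, h⟩
    refine mem_dirichletDom_iff.2 ⟨toN hf, mem_DSpace_iff_trace_eq_zero.2 ?_, fn_toN hf⟩
    rwa [fn_toN]

end WGraph

/-! ## The Dirichlet and the Neumann Laplacian -/

namespace WGraph

open FullAtoms

variable {X : Type*} [Countable X] [MeasurableSpace X] [DiscreteMeasurableSpace X]
  {G : WGraph X} {m : Measure X} [FullAtoms m]

theorem energyBilin_delta {f : X → ℝ} (hf : G.FinEnergy f) (x : X) :
    G.energyBilin (delta m x) f = m.real {x} * G.lap m f x := by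
  classical
  rw [coe_delta, energyBilin_single hf, lap]
  have := (real_pos m x).ne'
  field_simp

/-- A closed form that acts on indicator functions of points as the energy is associated with a
restriction of the formal Laplacian. -/
theorem exists_lapRestriction {Q : HForm (Lp ℝ 2 m)} (hQ : Q.IsForm) (hc : Q.Closed)
    (hd : ∀ x, delta m x ∈ Q.dom)
    (hval : ∀ x, ∀ f ∈ Q.dom, Q.val (delta m x) f = m.real {x} * G.lap m f x)
    {D : Set (X → ℝ)} (hD : ∀ f : Lp ℝ 2 m, (f : X → ℝ) ∈ D ↔ f ∈ Q.dom ∧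
      MemLp (G.lap m f) 2 m ∧ ∀ g ∈ Q.dom, Q.val g f = ∫ x, g x * G.lap m f x ∂m) :
    ∃ L : Lp ℝ 2 m →ₗ.[ℝ] Lp ℝ 2 m, HForm.IsOperatorOf L Q ∧ G.IsLapRestriction m L D := by
  obtain ⟨L, hL, hdom, hLv⟩ := hQ.exists_operator hc (dense_of_delta_mem hQ hd)
  -- Testing the weak equation with the indicator of x identifies v(x) with ℒf(x).
  have hlap : ∀ f ∈ Q.dom, ∀ v : Lp ℝ 2 m, (∀ g ∈ Q.dom, Q.val g f = inner ℝ g v) →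
      (v : X → ℝ) = G.lap m f := by
    intro f hf v hv
    ext x
    have h := hv _ (hd x)
    rw [hval x f hf, inner_delta] at h
    exact (mul_left_cancel₀ (real_pos m x).ne' h).symm
  refine ⟨L, hL, fun f => ?_, fun f x => ?_⟩
  · rw [hdom, hD]
    refine and_congr_right fun hf => ⟨?_, ?_⟩
    · rintro ⟨v, hv⟩
      have h := hlap f hf v hv
      refine ⟨h ▸ Lp.memLp v, fun g hg => ?_⟩
      rw [hv g hg, inner_eq_integral, h]
    · rintro ⟨hm, h⟩
      refine ⟨hm.toLp _, fun g hg => ?_⟩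
      rw [h g hg, inner_eq_integral, coe_toLp]
  · exact congrFun (hlap f ((hdom f).1 f.2).1 (L f) (hLv f)) x

theorem exists_neumannLaplacian :
    ∃ L : Lp ℝ 2 m →ₗ.[ℝ] Lp ℝ 2 m, HForm.IsOperatorOf L (G.neumannForm m) ∧
      G.IsLapRestriction m L {f | f ∈ G.neumannDom m ∧ MemLp (G.lap m f) 2 m ∧
        ∀ g ∈ G.neumannDom m, G.normalFunctional m f g = 0} := by
  refine exists_lapRestriction (G.neumannForm_isForm m) (G.neumannForm_closed m)
    (G.delta_mem_neumannForm m)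
    (fun x f hf => energyBilin_delta ((G.mem_neumannDom m).1 hf).2 x) fun f => ?_
  refine and_congr_right fun hf => and_congr_right fun _ => ⟨fun h g hg => ?_, fun h g hg => ?_⟩
  · have h1 := h g hg
    rw [normalFunctional, sub_eq_zero] at h1
    rw [(G.neumannForm_isForm m).symm _ hg _ hf]
    refine h1.trans (integral_congr_ae (Eventually.of_forall fun x => mul_comm _ _))
  · have h1 : (G.neumannForm m).val (hg.1.toLp g) f = _ := h (hg.1.toLp g) (by
      change (hg.1.toLp g : X → ℝ) ∈ G.neumannDom m
      rwa [coe_toLp])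
    change G.energyBilin (hg.1.toLp g : X → ℝ) f = _ at h1
    rw [coe_toLp] at h1
    rw [normalFunctional, sub_eq_zero, ((G.mem_neumannDom m).1 hf).2.energyBilin_comm
      ((G.mem_neumannDom m).1 hg).2]
    exact h1.trans (integral_congr_ae (Eventually.of_forall fun x => mul_comm _ _))

variable (G m) in
theorem mem_dirichletForm_iff {f : Lp ℝ 2 m} :
    f ∈ (G.dirichletForm m).dom ↔ ∃ F ∈ G.DSpace m, G.toL2 m F = f := by
  refine (mem_dirichletDom_iff (f := (f : X → ℝ))).trans ⟨?_, ?_⟩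
  · rintro ⟨F, hF, h⟩
    exact ⟨F, hF, by ext1; exact Eventually.of_forall (congrFun h)⟩
  · rintro ⟨F, hF, rfl⟩
    exact ⟨F, hF, rfl⟩

theorem dirichletForm_isForm : (G.dirichletForm m).IsForm := by
  have hQ := G.neumannForm_isForm m
  have hsub : ∀ f ∈ (G.dirichletForm m).dom, f ∈ (G.neumannForm m).dom := fun f hf => hf.1
  refine ⟨?_, ?_, ?_, fun f hf g hg => hQ.symm f (hsub f hf) g (hsub g hg),
    fun f hf g hg h hh => hQ.linear f (hsub f hf) g (hsub g hg) h (hsub h hh),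
    fun f hf => hQ.nonneg f (hsub f hf)⟩
  · exact (G.mem_dirichletForm_iff m).2 ⟨0, Submodule.zero_mem _, map_zero _⟩
  · intro f hf g hg
    obtain ⟨F, hF, rfl⟩ := (G.mem_dirichletForm_iff m).1 hf
    obtain ⟨F', hF', rfl⟩ := (G.mem_dirichletForm_iff m).1 hg
    exact (G.mem_dirichletForm_iff m).2 ⟨F + F', Submodule.add_mem _ hF hF', map_add _ _ _⟩
  · intro a f hf
    obtain ⟨F, hF, rfl⟩ := (G.mem_dirichletForm_iff m).1 hf
    exact (G.mem_dirichletForm_iff m).2 ⟨a • F, Submodule.smul_mem _ _ hF, map_smul _ _ _⟩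

theorem dirichletForm_closed : (G.dirichletForm m).Closed := by
  intro u hu hC
  obtain ⟨f, hf, hlim⟩ := G.neumannForm_closed m u (fun n => (hu n).1) hC
  refine ⟨f, ?_, hlim⟩
  choose U hUD hUu using fun n => (G.mem_dirichletForm_iff m).1 (hu n)
  refine (G.mem_dirichletForm_iff m).2 ⟨(G.neumannForm_isForm m).ofDom f hf, ?_,
    HForm.IsForm.toH_ofDom _ _ _⟩
  suffices hlimU : Tendsto U atTop (𝓝 ((G.neumannForm_isForm m).ofDom f hf)) from
    (G.isClosed_DSpace m).mem_of_tendsto hlimU (Eventually.of_forall hUD)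
  refine tendsto_iff_norm_sub_tendsto_zero.2 ?_
  have h2 : Tendsto (fun n => √((G.neumannForm m).normSq (u n - f))) atTop (𝓝 0) := by
    simpa [Function.comp_def] using (Real.continuous_sqrt.tendsto 0).comp hlim
  refine h2.congr fun n => ?_
  rw [← Real.sqrt_sq (norm_nonneg (U n - _)), HForm.IsForm.norm_sq_eq, map_sub,
    HForm.IsForm.toH_ofDom, hUu]

/-- Green's formula for functions in the Dirichlet space. -/
theorem energyBilin_eq_integral_of_mem_DSpace {F F' : G.NSpace m} (hF : F ∈ G.DSpace m)
    (hF' : MemLp (G.lap m (G.fn m F')) 2 m) :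
    G.energyBilin (G.fn m F) (G.fn m F') = ∫ x, G.fn m F x * G.lap m (G.fn m F') x ∂m := by
  set v := hF'.toLp _ with hv
  -- The functional l measures the failure of Green's formula. It is continuous and vanishes on
  -- indicators of points, hence on their closed span.
  let l : G.NSpace m →L[ℝ] ℝ :=
    ⟨(innerₛₗ ℝ F') - (innerₛₗ ℝ (v + G.toL2 m F')).comp (G.toL2 m),
      (continuous_const.inner continuous_id).sub
        (continuous_const.inner (G.continuous_toL2 m))⟩
  have hl : ∀ E, l E = inner ℝ F' E - inner ℝ (v + G.toL2 m F') (G.toL2 m E) := fun E => rfl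
  have hle : G.DSpace m ≤ LinearMap.ker (l : G.NSpace m →ₗ[ℝ] ℝ) := by
    refine Submodule.topologicalClosure_minimal _ (Submodule.span_le.2 ?_) l.isClosed_ker
    rintro _ ⟨x, rfl⟩
    change l _ = 0
    rw [hl, real_inner_comm, inner_deltaN, deltaN, HForm.IsForm.toH_ofDom, real_inner_comm,
      inner_delta, coe_add, hv, coe_toLp]
    exact sub_self _
  have h0 : l F = 0 := hle hF
  rw [hl, sub_eq_zero, HForm.IsForm.inner_def, inner_add_left, add_left_inj, real_inner_comm,
    inner_eq_integral, hv, coe_toLp] at h0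
  rw [(G.fn_finEnergy m F).energyBilin_comm (G.fn_finEnergy m F')]
  exact h0

/-- On the Dirichlet domain the weak equation is Green's formula, valid as soon as ℒf ∈ ℓ²; the zero
trace only encodes membership in the form domain. -/
theorem exists_dirichletLaplacian :
    ∃ L : Lp ℝ 2 m →ₗ.[ℝ] Lp ℝ 2 m, HForm.IsOperatorOf L (G.dirichletForm m) ∧
      G.IsLapRestriction m L {f | f ∈ G.neumannDom m ∧ MemLp (G.lap m f) 2 m ∧
        ∀ z, G.trace m f z = 0} := by
  refine exists_lapRestriction dirichletForm_isForm dirichletForm_closed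
    (fun x => (G.mem_dirichletForm_iff m).2 ⟨_, G.deltaN_mem_DSpace m x,
      HForm.IsForm.toH_ofDom _ _ _⟩)
    (fun x f hf => energyBilin_delta ((G.mem_neumannDom m).1 hf.1).2 x) fun f => ?_
  constructor
  · rintro ⟨hf, hm, ht⟩
    have hfD : f ∈ (G.dirichletForm m).dom := mem_dirichletDom_iff_trace.2 ⟨hf, ht⟩
    refine ⟨hfD, hm, fun g hg => ?_⟩
    obtain ⟨F, hF, rfl⟩ := (G.mem_dirichletForm_iff m).1 hfD
    obtain ⟨F', hF', rfl⟩ := (G.mem_dirichletForm_iff m).1 hg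
    exact energyBilin_eq_integral_of_mem_DSpace hF' hm
  · rintro ⟨hf, hm, -⟩
    exact ⟨hf.1, hm, (mem_dirichletDom_iff_trace.1 hf).2⟩

end WGraph

theorem ENNReal.add_sq_le_four_mul (a b : ℝ≥0∞) : (a + b) ^ 2 ≤ 4 * (a ^ 2 + b ^ 2) := by
  have h : ∀ c d : ℝ≥0∞, c ≤ d → (c + d) ^ 2 ≤ 4 * (c ^ 2 + d ^ 2) := fun c d hcd =>
    calc (c + d) ^ 2 ≤ (d + d) ^ 2 := pow_le_pow_left' (add_le_add_left hcd d) 2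
      _ = 4 * d ^ 2 := by ring
      _ ≤ 4 * (c ^ 2 + d ^ 2) := mul_le_mul_right le_add_self 4
  rcases le_total a b with hab | hab
  · exact h a b hab
  · rw [add_comm a b, add_comm (a ^ 2)]
    exact h b a hab

namespace WGraph

open FullAtoms

variable {X : Type*} [Countable X] [MeasurableSpace X] [DiscreteMeasurableSpace X]
  {G : WGraph X} {m : Measure X} {μ : Measure (G.Bdry m)} {β : G.Bdry m → ℝ≥0∞}

/-! ## The boundary energy -/

theorem continuous_trace {f : X → ℝ} (hf : f ∈ G.neumannDom m) : Continuous (G.trace m f) :=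
  (G.continuous_ext m hf).comp continuous_subtype_val

theorem continuous_trace₀ (f : G.bddDom m) : Continuous (G.trace₀ m f) :=
  (G.continuous_bddExt m f).comp continuous_subtype_val

theorem measurable_trace {f : X → ℝ} (hf : f ∈ G.neumannDom m) : Measurable (G.trace m f) :=
  (continuous_trace hf).measurable

theorem measurable_absTrace {f : X → ℝ} (hf : f ∈ G.neumannDom m) :
    Measurable fun z : G.Bdry m => (G.trace m f z).abs :=
  (EReal.continuous_abs.comp (continuous_trace hf)).measurable

theorem bdryEnergy_eq (hβ : Measurable β) {f : X → ℝ} (hf : f ∈ G.neumannDom m) :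
    G.bdryEnergy m μ β f = ∫⁻ z, (G.trace m f z).abs ^ 2 ∂(μ.withDensity β) := by
  rw [lintegral_withDensity_eq_lintegral_mul μ hβ ((measurable_absTrace hf).pow_const 2)]
  exact lintegral_congr fun z => mul_comm _ _

/-- `EReal.toReal` sends ±∞ to 0; finiteness almost everywhere for βμ makes this default harmless in
`bdryBilin`. -/
theorem ae_abs_trace_ne_top (hβ : Measurable β) {f : X → ℝ} (hf : f ∈ G.neumannDom m)
    (h : G.bdryEnergy m μ β f < ∞) : ∀ᵐ z ∂(μ.withDensity β), (G.trace m f z).abs ≠ ∞ := by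
  rw [bdryEnergy_eq hβ hf] at h
  filter_upwards [ae_lt_top ((measurable_absTrace hf).pow_const 2) h.ne] with z hz
  intro h'
  simp [h'] at hz

theorem ofReal_sq_toReal_trace {f : X → ℝ} {z : G.Bdry m} (h : (G.trace m f z).abs ≠ ∞) :
    ENNReal.ofReal ((G.trace m f z).toReal ^ 2) = (G.trace m f z).abs ^ 2 := by
  rw [← EReal.ofReal_abs_toReal_of_abs_ne_top h, ← ENNReal.ofReal_pow (abs_nonneg _), sq_abs]

theorem memLp_toReal_trace (hβ : Measurable β) {f : X → ℝ} (hf : f ∈ G.neumannDom m)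
    (h : G.bdryEnergy m μ β f < ∞) :
    MemLp (fun z => (G.trace m f z).toReal) 2 (μ.withDensity β) := by
  have hmeas : AEStronglyMeasurable (fun z => (G.trace m f z).toReal) (μ.withDensity β) :=
    (measurable_trace hf).ereal_toReal.aestronglyMeasurable
  refine (memLp_two_iff_integrable_sq hmeas).2 ⟨hmeas.pow 2, ?_⟩
  rw [hasFiniteIntegral_iff_ofReal (Eventually.of_forall fun z => sq_nonneg _)]
  rw [bdryEnergy_eq hβ hf] at h
  refine lt_of_le_of_lt (le_of_eq (lintegral_congr_ae ?_)) h
  filter_upwards [ae_abs_trace_ne_top hβ hf (by rwa [bdryEnergy_eq hβ hf])] with z hz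
  exact ofReal_sq_toReal_trace hz

theorem bdryBilin_self (hβ : Measurable β) {f : X → ℝ} (hf : f ∈ G.neumannDom m)
    (h : G.bdryEnergy m μ β f < ∞) :
    G.bdryBilin m μ β f f = (G.bdryEnergy m μ β f).toReal := by
  rw [bdryBilin, integral_eq_lintegral_of_nonneg_ae
    (Eventually.of_forall fun z => mul_self_nonneg _)
    ((measurable_trace hf).ereal_toReal.mul (measurable_trace hf).ereal_toReal).aestronglyMeasurable,
    bdryEnergy_eq hβ hf]
  congr 1
  refine lintegral_congr_ae ?_
  filter_upwards [ae_abs_trace_ne_top hβ hf h] with z hz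
  rw [← ofReal_sq_toReal_trace hz, sq]

theorem bdryBilin_comm (f g : X → ℝ) :
    G.bdryBilin m μ β f g = G.bdryBilin m μ β g f :=
  integral_congr_ae (Eventually.of_forall fun _ => mul_comm _ _)

theorem toReal_trace_linear {f g : X → ℝ} (hf : f ∈ G.neumannDom m) (hg : g ∈ G.neumannDom m)
    (a b : ℝ) {z : G.Bdry m} (h : (G.trace m f z).abs ≠ ∞) (h' : (G.trace m g z).abs ≠ ∞) :
    (G.trace m (a • f + b • g) z).toReal =
      a * (G.trace m f z).toReal + b * (G.trace m g z).toReal := by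
  have h1 := ((tendsto_toReal_ext hf h).const_mul a).add ((tendsto_toReal_ext hg h').const_mul b)
  rw [trace, ext_eq_of_tendsto (add_mem_neumannDom (smul_mem_neumannDom hf a)
    (smul_mem_neumannDom hg b)) h1, EReal.toReal_coe]
  rfl

theorem bdryBilin_linear (hβ : Measurable β) {f g h : X → ℝ} (hf : f ∈ G.neumannDom m)
    (hg : g ∈ G.neumannDom m) (hh : h ∈ G.neumannDom m) (ef : G.bdryEnergy m μ β f < ∞)
    (eg : G.bdryEnergy m μ β g < ∞) (eh : G.bdryEnergy m μ β h < ∞) (a b : ℝ) :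
    G.bdryBilin m μ β f (a • g + b • h) =
      a * G.bdryBilin m μ β f g + b * G.bdryBilin m μ β f h := by
  have mf := memLp_toReal_trace hβ hf ef
  have ig : Integrable (fun z => a * ((G.trace m f z).toReal * (G.trace m g z).toReal))
      (μ.withDensity β) := (mf.integrable_mul (memLp_toReal_trace hβ hg eg)).const_mul a
  have ih : Integrable (fun z => b * ((G.trace m f z).toReal * (G.trace m h z).toReal))
      (μ.withDensity β) := (mf.integrable_mul (memLp_toReal_trace hβ hh eh)).const_mul b
  simp only [bdryBilin]
  rw [← integral_const_mul, ← integral_const_mul, ← integral_add ig ih]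
  refine integral_congr_ae ?_
  filter_upwards [ae_abs_trace_ne_top hβ hg eg, ae_abs_trace_ne_top hβ hh eh] with z h1 h2
  rw [toReal_trace_linear hg hh a b h1 h2]
  ring

theorem bdryEnergy_add_lt_top (hβ : Measurable β) {f g : X → ℝ} (hf : f ∈ G.neumannDom m)
    (hg : g ∈ G.neumannDom m) (ef : G.bdryEnergy m μ β f < ∞) (eg : G.bdryEnergy m μ β g < ∞) :
    G.bdryEnergy m μ β (f + g) < ∞ := by
  rw [bdryEnergy_eq hβ hf] at ef
  rw [bdryEnergy_eq hβ hg] at eg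
  rw [bdryEnergy_eq hβ (add_mem_neumannDom hf hg)]
  calc ∫⁻ z, (G.trace m (f + g) z).abs ^ 2 ∂(μ.withDensity β)
      ≤ ∫⁻ z, 4 * ((G.trace m f z).abs ^ 2 + (G.trace m g z).abs ^ 2) ∂(μ.withDensity β) :=
        lintegral_mono fun z => (pow_le_pow_left' (absExt_add_le hf hg z.1) 2).trans
          (ENNReal.add_sq_le_four_mul _ _)
    _ = 4 * (∫⁻ z, (G.trace m f z).abs ^ 2 ∂(μ.withDensity β) +
          ∫⁻ z, (G.trace m g z).abs ^ 2 ∂(μ.withDensity β)) := by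
        rw [lintegral_const_mul' _ _ (by simp), lintegral_add_left ((measurable_absTrace hf).pow_const 2)]
    _ < ∞ := ENNReal.mul_lt_top (by simp) (ENNReal.add_lt_top.2 ⟨ef, eg⟩)

theorem bdryEnergy_smul_lt_top (hβ : Measurable β) {f : X → ℝ} (hf : f ∈ G.neumannDom m)
    (ef : G.bdryEnergy m μ β f < ∞) (a : ℝ) : G.bdryEnergy m μ β (a • f) < ∞ := by
  rw [bdryEnergy_eq hβ hf] at ef
  rw [bdryEnergy_eq hβ (smul_mem_neumannDom hf a)]
  have h : ∀ z, (G.trace m (a • f) z).abs ^ 2 =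
      ENNReal.ofReal |a| ^ 2 * (G.trace m f z).abs ^ 2 := fun z => by
    rw [← mul_pow]
    exact congrArg (· ^ 2) (absExt_smul hf a z.1)
  simp only [h]
  rw [lintegral_const_mul _ ((measurable_absTrace hf).pow_const 2)]
  exact ENNReal.mul_lt_top (by simp) ef

theorem bdryEnergy_le_of_abs_le {f g : X → ℝ} (hf : f ∈ G.neumannDom m)
    (hg : g ∈ G.neumannDom m) (h : ∀ x, |f x| ≤ |g x|) :
    G.bdryEnergy m μ β f ≤ G.bdryEnergy m μ β g :=
  lintegral_mono fun z => mul_le_mul_left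
    (pow_le_pow_left' (absExt_le_of_abs_le hf hg h z.1) 2) _

theorem bdryEnergy_eq_zero_of_trace {f : X → ℝ} (h : ∀ z, G.trace m f z = 0) :
    G.bdryEnergy m μ β f = 0 := by
  simp [bdryEnergy, h]

theorem bdryBilin_eq_zero_of_trace {f : X → ℝ} (h : ∀ z, G.trace m f z = 0) (g : X → ℝ) :
    G.bdryBilin m μ β f g = 0 := by
  simp [bdryBilin, h]

/-- Functions of finite boundary energy vanish on the support of `1_{β = ∞} μ`. -/
theorem trace_eq_zero_of_mem_bdryF (hβ : Measurable β) {f : X → ℝ} (hf : f ∈ G.neumannDom m)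
    (h : G.bdryEnergy m μ β f < ∞) {z : G.Bdry m} (hz : z ∈ G.bdryF m μ β) :
    G.trace m f z = 0 := by
  by_contra hne
  -- If this open set contains a point of F_β, it meets {β = ∞} in positive measure, and there the
  -- integrand is infinite.
  have hopen : IsOpen {w | G.trace m f w ≠ 0} :=
    isOpen_ne_fun (continuous_trace hf) continuous_const
  have hpos := hz _ hopen hne
  refine hpos.ne' (measure_mono_null ?_ (ae_iff.1 (ae_lt_top
    (((measurable_absTrace hf).pow_const 2).mul hβ) h.ne)))
  rintro w ⟨hw, hw'⟩
  have h1 : (G.trace m f w).abs ^ 2 ≠ 0 := pow_ne_zero 2 (by rwa [ne_eq, EReal.abs_eq_zero_iff])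
  change ¬ (G.trace m f w).abs ^ 2 * β w < ∞
  rw [show β w = ∞ from hw, ENNReal.mul_top h1]
  exact lt_irrefl _

/-! ## Harmonic measures and convergence of traces -/

variable [FullAtoms m]

/-- Every bounded function in the Neumann space differs from its harmonic extension by an element
of the Dirichlet space. -/
theorem exists_isHarmonicExt {A : G.NSpace m} (hA : ∃ K : ℝ, ∀ x, |G.fn m A x| ≤ K) :
    ∃ P ∈ G.DSpace m, ∃ H ∈ (G.DSpace m)ᗮ, A = P + H ∧ ‖H‖ ≤ ‖A‖ ∧
      G.IsHarmonicExt m (fun z => (G.trace₀ m ⟨G.fn m A, G.fn_mem m A, hA⟩ z : EReal))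
        (G.fn m H) := by
  -- Orthogonal decomposition along the Dirichlet space: H is harmonic by orthogonality, and has the
  -- trace of A because the trace of P vanishes.
  obtain ⟨P, hP, H, hH, h⟩ := (G.DSpace m).exists_add_mem_mem_orthogonal A
  refine ⟨P, hP, H, hH, h, ?_, G.fn_mem m H, lap_add_eq_zero_of_mem_orthogonal hH, ?_⟩
  · refine le_of_sq_le_sq ?_ (norm_nonneg A)
    rw [h, norm_add_sq_real, (Submodule.mem_orthogonal _ _).1 hH _ hP]
    linarith [sq_nonneg ‖P‖]
  · ext1 z
    have h1 : Tendsto (G.fn m P) (G.nhdsIn m z.1) (𝓝 0) := by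
      have hz : G.ext m (G.fn m P) z.1 = 0 := trace_eq_zero_of_mem_DSpace hP z
      have := tendsto_toReal_ext (G.fn_mem m P) (p := z.1) (by simp [absExt, hz])
      rwa [hz, EReal.toReal_zero] at this
    have h2 := (tendsto_bddExt ⟨G.fn m A, G.fn_mem m A, hA⟩ z.1).sub h1
    refine ext_eq_of_tendsto (G.fn_mem m H) ?_
    rw [sub_zero] at h2
    refine h2.congr fun x => ?_
    simp [h]

namespace IsHarmonicMeasure

variable {o : X}

theorem isFiniteMeasure (hμ : G.IsHarmonicMeasure m o μ) : IsFiniteMeasure μ :=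
  ⟨hμ.mass_le.trans_lt ENNReal.one_lt_top⟩

/-- The trace of A = min(1, |F|) is the integrand. Its integral is the value at o of the projection
H of A, and ‖H‖ ≤ ‖A‖ ≤ ‖F‖. -/
theorem lintegral_min_trace_le (hμ : G.IsHarmonicMeasure m o μ) (F : G.NSpace m) :
    ∫⁻ z, min (G.trace m (G.fn m F) z).abs 1 ∂μ ≤
      ENNReal.ofReal ((√(m.real {o}))⁻¹ * ‖F‖) := by
  have := hμ.isFiniteMeasure
  set A : G.NSpace m := contract (lipschitzWith_clamp 1) (clamp_zero zero_le_one) (absN F) with hAdef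
  have hAx : ∀ x, G.fn m A x = min 1 |G.fn m F x| := fun x => by
    simp only [hAdef, fn_contract, fn_absN]
    exact max_eq_right (by linarith [le_min zero_le_one (abs_nonneg (G.fn m F x))])
  have hA : ∃ K : ℝ, ∀ x, |G.fn m A x| ≤ K := ⟨1, fun x => by
    rw [hAx, abs_of_nonneg (le_min zero_le_one (abs_nonneg _))]
    exact min_le_left _ _⟩
  obtain ⟨P, hP, H, hH, h, hle, hext⟩ := exists_isHarmonicExt hA
  have hrepr := hμ.repr _ _ hext
  set a : G.bddDom m := ⟨G.fn m A, G.fn_mem m A, hA⟩ with ha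
  have htr : ∀ z : G.Bdry m, min (G.trace m (G.fn m F) z).abs 1 =
      ENNReal.ofReal (G.trace₀ m a z) := fun z => by
    refine tendsto_nhds_unique ((tendsto_absExt (G.fn_mem m F) z.1).min tendsto_const_nhds)
      (((ENNReal.continuous_ofReal.tendsto _).comp (tendsto_bddExt a z.1)).congr fun x => ?_)
    simp only [ha, Function.comp_apply]
    rw [hAx, ENNReal.ofReal_min, ENNReal.ofReal_one, min_comm]
  have hnn : ∀ z : G.Bdry m, 0 ≤ G.trace₀ m a z := fun z =>
    ge_of_tendsto' (tendsto_bddExt a z.1) fun x => by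
      simp only [ha]
      rw [hAx]
      exact le_min zero_le_one (abs_nonneg _)
  have hle1 : ∀ z : G.Bdry m, G.trace₀ m a z ≤ 1 := fun z =>
    le_of_tendsto' (tendsto_bddExt a z.1) fun x => by
      simp only [ha]
      rw [hAx]
      exact min_le_left _ _
  have hint : Integrable (G.trace₀ m a) μ :=
    Integrable.of_bound (continuous_trace₀ a).measurable.aestronglyMeasurable 1
      (Eventually.of_forall fun z => by
        rw [Real.norm_eq_abs, abs_of_nonneg (hnn z)]
        exact hle1 z)
  simp only [htr]
  rw [← ofReal_integral_eq_lintegral_ofReal hint (Eventually.of_forall hnn), ← hrepr]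
  refine ENNReal.ofReal_le_ofReal ((le_abs_self _).trans ((abs_fn_apply_le H o).trans ?_))
  refine mul_le_mul_of_nonneg_left (hle.trans ?_) (inv_nonneg.2 (Real.sqrt_nonneg _))
  exact (norm_contract_le _ _ _).trans (norm_absN_le F)

/-- Convergence in the Neumann space implies almost sure convergence of the traces of a
subsequence. -/
theorem exists_subseq_tendsto_trace (hμ : G.IsHarmonicMeasure m o μ) {U : ℕ → G.NSpace m}
    (hU : Tendsto U atTop (𝓝 0)) : ∃ ns : ℕ → ℕ, StrictMono ns ∧
      ∀ᵐ z ∂μ, Tendsto (fun k => (G.trace m (G.fn m (U (ns k))) z).abs) atTop (𝓝 0) := by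
  have hlim : Tendsto (fun k => ENNReal.ofReal ((√(m.real {o}))⁻¹ * ‖U k‖)) atTop (𝓝 0) := by
    have := (tendsto_norm_zero.comp hU).const_mul (√(m.real {o}))⁻¹
    rw [mul_zero] at this
    rw [← ENNReal.ofReal_zero]
    exact (ENNReal.continuous_ofReal.tendsto _).comp this
  -- A Borel–Cantelli argument: along a subsequence with integrals below the summable δ, the sum of
  -- the truncated traces is integrable, so its terms tend to zero almost everywhere.
  obtain ⟨δ, hδ, hδs⟩ := ENNReal.exists_pos_sum_of_countable' one_ne_zero ℕ
  obtain ⟨ns, hns, hlt⟩ := extraction_forall_of_eventually fun k =>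
    (hlim.eventually (gt_mem_nhds (hδ k)))
  refine ⟨ns, hns, ?_⟩
  have hmeas : ∀ k, Measurable fun z => min (G.trace m (G.fn m (U (ns k))) z).abs 1 := fun k =>
    (measurable_absTrace (G.fn_mem m _)).min measurable_const
  have hsum : ∫⁻ z, ∑' k, min (G.trace m (G.fn m (U (ns k))) z).abs 1 ∂μ ≠ ∞ := by
    rw [lintegral_tsum fun k => (hmeas k).aemeasurable]
    refine ne_top_of_le_ne_top ENNReal.one_ne_top (le_trans (ENNReal.tsum_le_tsum fun k => ?_) hδs.le)
    exact (hμ.lintegral_min_trace_le _).trans (hlt k).le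
  filter_upwards [ae_lt_top (Measurable.tsum hmeas) hsum] with z hz
  have h0 := ENNReal.tendsto_atTop_zero_of_tsum_ne_top hz.ne
  refine h0.congr' ?_
  filter_upwards [h0.eventually (gt_mem_nhds one_pos)] with k hk
  exact min_eq_left (not_lt.1 fun h => by
    rw [min_eq_right h.le] at hk
    exact lt_irrefl _ hk)

/-- The boundary energy is lower semicontinuous on the Neumann space. -/
theorem bdryEnergy_le_of_tendsto (hμ : G.IsHarmonicMeasure m o μ) (hβ : Measurable β)
    {U : ℕ → G.NSpace m} {F : G.NSpace m} (hU : Tendsto U atTop (𝓝 F)) {C : ℝ≥0∞}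
    (hC : ∀ᶠ n in atTop, G.bdryEnergy m μ β (G.fn m (U n)) ≤ C) :
    G.bdryEnergy m μ β (G.fn m F) ≤ C := by
  have hU' : Tendsto (fun n => F - U n) atTop (𝓝 0) := by
    simpa using (tendsto_const_nhds (x := F)).sub hU
  obtain ⟨ns, hns, hlim⟩ := hμ.exists_subseq_tendsto_trace hU'
  set T : G.NSpace m → G.Bdry m → ℝ≥0∞ := fun E z => (G.trace m (G.fn m E) z).abs with hT
  have hTm : ∀ E, Measurable (T E) := fun E => measurable_absTrace (G.fn_mem m E)
  -- The truncated difference converges to T F almost everywhere, even where T F = ∞, so Fatou's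
  -- lemma applies to it in place of T (U (ns k)).
  have hle : ∀ k z, T F z - T (F - U (ns k)) z ≤ T (U (ns k)) z := fun k z => by
    rw [tsub_le_iff_right]
    have h1 := absExt_add_le (G.fn_mem m (U (ns k))) (G.fn_mem m (F - U (ns k))) z.1
    rw [← map_add, add_sub_cancel] at h1
    exact h1
  have hC' : ∀ᶠ k in atTop, ∫⁻ z, (T F z - T (F - U (ns k)) z) ^ 2 ∂(μ.withDensity β) ≤ C := by
    filter_upwards [hns.tendsto_atTop.eventually hC] with k hk
    rw [bdryEnergy_eq hβ (G.fn_mem m _)] at hk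
    exact (lintegral_mono fun z => pow_le_pow_left' (hle k z) 2).trans hk
  rw [bdryEnergy_eq hβ (G.fn_mem m _)]
  calc ∫⁻ z, T F z ^ 2 ∂(μ.withDensity β)
      = ∫⁻ z, liminf (fun k => (T F z - T (F - U (ns k)) z) ^ 2) atTop ∂(μ.withDensity β) := by
        refine lintegral_congr_ae ?_
        -- A μ-null set is βμ-null even if β takes the value ∞.
        filter_upwards [withDensity_absolutelyContinuous μ β hlim] with z hz
        have h1 := (ENNReal.continuous_pow 2).tendsto _ |>.comp
          (ENNReal.Tendsto.sub (tendsto_const_nhds (x := T F z)) hz (Or.inr ENNReal.zero_ne_top))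
        rw [tsub_zero] at h1
        exact h1.liminf_eq.symm
    _ ≤ liminf (fun k => ∫⁻ z, (T F z - T (F - U (ns k)) z) ^ 2 ∂(μ.withDensity β)) atTop :=
        lintegral_liminf_le fun k => ((hTm _).sub (hTm _)).pow_const 2
    _ ≤ C := liminf_le_of_frequently_le' hC'.frequently

end IsHarmonicMeasure

/-! ## The Robin forms -/

theorem robinForm_isForm (hβ : Measurable β) : (G.robinForm m μ β).IsForm where
  zero_mem := by
    have h0 := (G.neumannForm_isForm m).zero_mem
    refine ⟨h0, ?_⟩
    rw [coe_zero, bdryEnergy_eq_zero_of_trace fun z => ?_]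
    · exact ENNReal.zero_lt_top
    · simpa using trace_eq_zero_of_mem_DSpace (G.DSpace m).zero_mem z
  add_mem f hf g hg := by
    refine ⟨(G.neumannForm_isForm m).add_mem f hf.1 g hg.1, ?_⟩
    rw [coe_add]
    exact bdryEnergy_add_lt_top hβ hf.1 hg.1 hf.2 hg.2
  smul_mem a f hf := by
    refine ⟨(G.neumannForm_isForm m).smul_mem a f hf.1, ?_⟩
    rw [coe_smul]
    exact bdryEnergy_smul_lt_top hβ hf.1 hf.2 a
  symm f hf g hg := congrArg₂ (· + ·) ((G.neumannForm_isForm m).symm f hf.1 g hg.1)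
    (bdryBilin_comm _ _)
  linear f hf g hg h hh a b := by
    have h1 := (G.neumannForm_isForm m).linear f hf.1 g hg.1 h hh.1 a b
    have h2 := bdryBilin_linear hβ hf.1 hg.1 hh.1 hf.2 hg.2 hh.2 a b
    rw [← coe_smul, ← coe_smul, ← coe_add] at h2
    simp only [neumannForm] at h1
    simp only [robinForm]
    rw [h1, h2]
    ring
  nonneg f hf := add_nonneg ((G.neumannForm_isForm m).nonneg f hf.1) (by
    rw [bdryBilin_self hβ hf.1 hf.2]
    exact ENNReal.toReal_nonneg)

theorem delta_mem_robinForm (x : X) : delta m x ∈ (G.robinForm m μ β).dom := by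
  refine ⟨G.delta_mem_neumannForm m x, ?_⟩
  have h := bdryEnergy_eq_zero_of_trace (μ := μ) (β := β)
    (trace_eq_zero_of_mem_DSpace (G.deltaN_mem_DSpace m x))
  exact h.trans_lt ENNReal.zero_lt_top

/-- The squared form norm is that of Q^(N) plus the boundary energy. The Neumann limit f exists by
closedness of Q^(N), and lower semicontinuity of the boundary energy along u n - u k as k → ∞ shows
that the boundary energy of u n - f tends to zero. -/
theorem IsHarmonicMeasure.robinForm_closed {o : X} (hμ : G.IsHarmonicMeasure m o μ)
    (hβ : Measurable β) : (G.robinForm m μ β).Closed := by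
  intro u hu hC
  have hQ := robinForm_isForm (G := G) (m := m) (μ := μ) hβ
  have hsub : ∀ f ∈ (G.robinForm m μ β).dom, ∀ g ∈ (G.robinForm m μ β).dom,
      f - g ∈ (G.robinForm m μ β).dom := fun f hf g hg => hQ.submodule.sub_mem hf hg
  have hval : ∀ f ∈ (G.robinForm m μ β).dom, (G.robinForm m μ β).normSq f =
      (G.neumannForm m).normSq f + (G.bdryEnergy m μ β f).toReal := fun f hf => by
    rw [HForm.normSq, HForm.normSq, ← bdryBilin_self hβ hf.1 hf.2]
    simp only [robinForm, neumannForm]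
    ring
  have hN0 : ∀ f ∈ (G.neumannForm m).dom, 0 ≤ (G.neumannForm m).normSq f := fun f hf =>
    add_nonneg ((G.neumannForm_isForm m).nonneg f hf) (sq_nonneg _)
  obtain ⟨f, hf, hlim⟩ := G.neumannForm_closed m u (fun n => (hu n).1) fun ε hε => by
    obtain ⟨N, hN⟩ := hC ε hε
    refine ⟨N, fun n hn k hk => lt_of_le_of_lt ?_ (hN n hn k hk)⟩
    rw [hval _ (hsub _ (hu n) _ (hu k))]
    linarith [ENNReal.toReal_nonneg (a := G.bdryEnergy m μ β ((u n - u k : Lp ℝ 2 m) : X → ℝ))]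
  set hNf := G.neumannForm_isForm m
  set U : ℕ → G.NSpace m := fun n => hNf.ofDom (u n) (hu n).1
  set F : G.NSpace m := hNf.ofDom f hf
  have hUF : Tendsto U atTop (𝓝 F) := by
    refine tendsto_iff_norm_sub_tendsto_zero.2 ?_
    have h2 : Tendsto (fun n => √((G.neumannForm m).normSq (u n - f))) atTop (𝓝 0) := by
      simpa [Function.comp_def] using (Real.continuous_sqrt.tendsto 0).comp hlim
    refine h2.congr fun n => ?_
    rw [← Real.sqrt_sq (norm_nonneg (U n - F)), HForm.IsForm.norm_sq_eq]
    rfl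
  have hB : ∀ ε : ℝ, 0 < ε → ∃ N, ∀ n ≥ N,
      G.bdryEnergy m μ β ((u n - f : Lp ℝ 2 m) : X → ℝ) ≤ ENNReal.ofReal ε := by
    intro ε hε
    obtain ⟨N, hN⟩ := hC ε hε
    refine ⟨N, fun n hn => ?_⟩
    refine hμ.bdryEnergy_le_of_tendsto hβ (U := fun k => U n - U k) (F := U n - F)
      (tendsto_const_nhds.sub hUF) ?_
    filter_upwards [eventually_ge_atTop N] with k hk
    have h1 := hN n hn k hk
    have hd := hsub _ (hu n) _ (hu k)
    rw [hval _ hd] at h1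
    change G.bdryEnergy m μ β ((u n - u k : Lp ℝ 2 m) : X → ℝ) ≤ _
    rw [← ENNReal.ofReal_toReal hd.2.ne]
    exact ENNReal.ofReal_le_ofReal (by linarith [hN0 _ hd.1])
  obtain ⟨N₀, hN₀⟩ := hB 1 one_pos
  have hmem : ∀ n ≥ N₀, u n - f ∈ (G.robinForm m μ β).dom := fun n hn =>
    ⟨hNf.submodule.sub_mem (hu n).1 hf, (hN₀ n hn).trans_lt ENNReal.ofReal_lt_top⟩
  refine ⟨f, by simpa using hsub _ (hu N₀) _ (hmem N₀ le_rfl), ?_⟩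
  have hb : Tendsto (fun n => (G.bdryEnergy m μ β ((u n - f : Lp ℝ 2 m) : X → ℝ)).toReal) atTop
      (𝓝 0) := by
    refine Metric.tendsto_atTop.2 fun ε hε => ?_
    obtain ⟨N, hN⟩ := hB (ε / 2) (by positivity)
    refine ⟨N, fun n hn => ?_⟩
    rw [Real.dist_eq, sub_zero, abs_of_nonneg ENNReal.toReal_nonneg]
    exact lt_of_le_of_lt (ENNReal.toReal_le_of_le_ofReal (by positivity) (hN n hn)) (by linarith)
  have hs := hlim.add hb
  rw [add_zero] at hs
  refine hs.congr' ?_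
  filter_upwards [eventually_ge_atTop N₀] with n hn
  exact (hval _ (hmem n hn)).symm

/-- The Robin form is a Dirichlet form. -/
theorem IsHarmonicMeasure.robinForm_isDirichletForm {o : X} (hμ : G.IsHarmonicMeasure m o μ)
    (hβ : Measurable β) : (G.robinForm m μ β).IsDirichletForm where
  isForm := robinForm_isForm hβ
  closed := hμ.robinForm_closed hβ
  dense := dense_of_delta_mem (robinForm_isForm hβ) delta_mem_robinForm
  markov C hC hC0 f hf := by
    have h1 : (hC.compLp hC0 f : X → ℝ) ∈ G.neumannDom m := by
      rw [coe_compLp]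
      exact comp_mem_neumannDom hf.1 hC hC0
    have h2 : G.bdryEnergy m μ β (hC.compLp hC0 f) ≤ G.bdryEnergy m μ β f :=
      bdryEnergy_le_of_abs_le h1 hf.1 fun x => by
        rw [coe_compLp]
        simpa [Real.dist_eq, hC0] using hC.dist_le_mul (f x) 0
    have h3 := h2.trans_lt hf.2
    refine ⟨⟨h1, h3⟩, ?_⟩
    simp only [robinForm]
    rw [bdryBilin_self hβ h1 h3, bdryBilin_self hβ hf.1 hf.2]
    refine add_le_add ?_ (ENNReal.toReal_mono hf.2.ne h2)
    rw [coe_compLp]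
    exact ((G.mem_neumannDom m).1 hf.1).2.energyBilin_comp_le hC hC0

/-- Finite boundary energy forces f and all test functions to vanish on F_β, so `robinDom` is
described by the weak equation of Q^β. Indicators of points have zero trace, so the boundary term
does not change the action of the operator. -/
theorem IsHarmonicMeasure.exists_robinLaplacian {o : X} (hμ : G.IsHarmonicMeasure m o μ)
    (hβ : Measurable β) :
    ∃ L : Lp ℝ 2 m →ₗ.[ℝ] Lp ℝ 2 m, HForm.IsOperatorOf L (G.robinForm m μ β) ∧
      G.IsLapRestriction m L (G.robinDom m μ β) := by
  have hcomm : ∀ f g : X → ℝ, ∫ x, G.lap m f x * g x ∂m = ∫ x, g x * G.lap m f x ∂m :=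
    fun f g => integral_congr_ae (Eventually.of_forall fun x => mul_comm _ _)
  have key : ∀ f g : X → ℝ, f ∈ G.neumannDom m → g ∈ G.neumannDom m →
      (G.normalFunctional m f g + G.bdryBilin m μ β f g = 0 ↔
        G.energyBilin g f + G.bdryBilin m μ β g f = ∫ x, g x * G.lap m f x ∂m) := by
    intro f g hf hg
    rw [normalFunctional, hcomm, ((G.mem_neumannDom m).1 hf).2.energyBilin_comm
      ((G.mem_neumannDom m).1 hg).2, bdryBilin_comm, ← sub_eq_zero (b := ∫ x, _ ∂m)]
    rw [sub_add_eq_add_sub]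
  refine exists_lapRestriction (robinForm_isForm hβ) (hμ.robinForm_closed hβ)
    delta_mem_robinForm (fun x f hf => ?_) fun f => ?_
  · have h := bdryBilin_eq_zero_of_trace (μ := μ) (β := β)
      (trace_eq_zero_of_mem_DSpace (G.deltaN_mem_DSpace m x)) (f : X → ℝ)
    have h2 : G.bdryBilin m μ β (delta m x) f = 0 := h
    simp only [robinForm]
    rw [h2, add_zero]
    exact energyBilin_delta ((G.mem_neumannDom m).1 hf.1).2 x
  · constructor
    · rintro ⟨hf, hm, he, -, h⟩
      exact ⟨⟨hf, he⟩, hm, fun g hg => (key f g hf hg.1).1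
        (h g hg.1 hg.2 fun z hz => trace_eq_zero_of_mem_bdryF hβ hg.1 hg.2 hz)⟩
    · rintro ⟨⟨hf, he⟩, hm, h⟩
      refine ⟨hf, hm, he, fun z hz => trace_eq_zero_of_mem_bdryF hβ hf he hz,
        fun g hg hge _ => (key f g hf hg).2 ?_⟩
      have h1 : (G.robinForm m μ β).val (hg.1.toLp g) f = _ := h (hg.1.toLp g) (by
        change (hg.1.toLp g : X → ℝ) ∈ G.neumannDom m ∧ G.bdryEnergy m μ β (hg.1.toLp g) < ∞
        rw [coe_toLp]
        exact ⟨hg, hge⟩)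
      simp only [robinForm] at h1
      rwa [coe_toLp] at h1

theorem neumannForm_same_robinForm : (G.neumannForm m).Same (G.robinForm m μ fun _ => 0) := by
  refine ⟨?_, fun f _ g _ => ?_⟩
  · ext f
    simp [neumannForm, robinForm, bdryEnergy]
  · have h : μ.withDensity (fun _ => 0) = 0 := by
      rw [withDensity_const, zero_smul]
    simp [neumannForm, robinForm, bdryBilin, h]

/-- On a connected graph, functions whose trace vanishes almost surely belong to the Dirichlet
space. -/
theorem IsHarmonicMeasure.mem_dirichletDom_of_ae {o : X} (hμ : G.IsHarmonicMeasure m o μ)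
    (hG : G.Connected) {f : X → ℝ} (hf : f ∈ G.neumannDom m)
    (h : ∀ᵐ z ∂μ, G.trace m f z = 0) : f ∈ G.dirichletDom m := by
  -- The function |arctan f| is bounded and nonnegative, and its trace vanishes wherever that of f
  -- does.
  set A : G.NSpace m := absN (contract lipschitzWith_arctan Real.arctan_zero (toN hf)) with hAd
  have hAx : ∀ x, G.fn m A x = |Real.arctan (f x)| := fun x => by
    simp only [hAd, fn_absN, fn_contract, fn_toN]
  have hle : ∀ x, |G.fn m A x| ≤ |f x| := fun x => by
    rw [hAx, abs_abs]
    simpa [Real.dist_eq] using lipschitzWith_arctan.dist_le_mul (f x) 0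
  have hA : ∃ K : ℝ, ∀ x, |G.fn m A x| ≤ K := ⟨Real.pi / 2, fun x => by
    rw [hAx, abs_abs]
    exact abs_le.2 ⟨(Real.neg_pi_div_two_lt_arctan _).le, (Real.arctan_lt_pi_div_two _).le⟩⟩
  obtain ⟨P, hP, H, hH, hPH, -, hext⟩ := exists_isHarmonicExt hA
  have hrepr := hμ.repr _ _ hext
  -- The harmonic part H is nonnegative and vanishes at o, hence everywhere by connectedness; A is
  -- then its own Dirichlet part.
  have h0 : G.fn m H o = 0 := by
    rw [hrepr]
    refine integral_eq_zero_of_ae ?_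
    filter_upwards [h] with z hz
    have h1 := absExt_le_of_abs_le (G.fn_mem m A) hf hle z.1
    rw [absExt_eq_zero_iff.2 hz, nonpos_iff_eq_zero, absExt_eq_zero_iff] at h1
    have h2 := G.trace_eq_trace₀ m ⟨G.fn m A, G.fn_mem m A, hA⟩ z
    exact EReal.coe_eq_zero.1 (h2.symm.trans h1)
  have hH0 : G.fn m H = 0 := eq_zero_of_connected hG (G.fn_finEnergy m H)
    (fn_nonneg_of_mem_orthogonal hP hH fun x => by
      rw [← hPH, hAx]
      exact abs_nonneg _)
    hext.2.1 h0
  have hAD : A ∈ G.DSpace m := by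
    rw [hPH, G.fn_injective m (hH0.trans (map_zero _).symm), add_zero]
    exact hP
  refine mem_dirichletDom_iff_trace.2 ⟨hf, fun z => ?_⟩
  -- The zero trace passes back from |arctan f| to arctan f, and through tan to f.
  have hz : G.ext m (G.fn m A) z.1 = 0 := trace_eq_zero_of_mem_DSpace hAD z
  have h1 := tendsto_toReal_ext (G.fn_mem m A) (p := z.1) (by simp [absExt, hz])
  rw [hz, EReal.toReal_zero] at h1
  have h2 : Tendsto (fun x => Real.arctan (f x)) (G.nhdsIn m z.1) (𝓝 0) :=
    (tendsto_zero_iff_abs_tendsto_zero _).2 (h1.congr hAx)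
  have h3 := (Real.continuousAt_tan.2 (by simp : Real.cos 0 ≠ 0)).tendsto.comp h2
  rw [Real.tan_zero] at h3
  exact ext_eq_of_tendsto hf (h3.congr fun x => Real.tan_arctan _)

theorem IsHarmonicMeasure.dirichletForm_same_robinForm {o : X} (hμ : G.IsHarmonicMeasure m o μ)
    (hG : G.Connected) : (G.dirichletForm m).Same (G.robinForm m μ fun _ => ∞) := by
  refine ⟨?_, fun f hf g _ => ?_⟩
  · ext f
    constructor
    · intro hf
      refine ⟨hf.1, ?_⟩
      rw [bdryEnergy_eq_zero_of_trace (mem_dirichletDom_iff_trace.1 hf).2]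
      exact ENNReal.zero_lt_top
    · rintro ⟨hf, he⟩
      refine hμ.mem_dirichletDom_of_ae hG hf ?_
      -- A finite integral of |f|² · ∞ forces the trace to vanish almost everywhere.
      filter_upwards [ae_lt_top (((measurable_absTrace hf).pow_const 2).mul_const _) he.ne]
        with z hz
      by_contra hne
      have h1 : (G.trace m f z).abs ^ 2 ≠ 0 :=
        pow_ne_zero 2 (by rwa [ne_eq, EReal.abs_eq_zero_iff])
      rw [ENNReal.mul_top h1] at hz
      exact lt_irrefl _ hz
  · simp only [dirichletForm, robinForm]
    rw [bdryBilin_eq_zero_of_trace (mem_dirichletDom_iff_trace.1 hf).2, add_zero]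

end WGraph

/-! ## The kernel of the normal derivative -/

namespace WGraph

open FullAtoms

variable {X : Type*} [Countable X] [MeasurableSpace X] [DiscreteMeasurableSpace X]
  {G : WGraph X} {m : Measure X} {μ : Measure (G.Bdry m)}

instance : T2Space (G.Bdry m) :=
  inferInstanceAs (T2Space {p : G.Hat m // p ∉ range (G.incl m) ∧
    ∀ f : G.bddDom m, (f : X → ℝ) ∈ G.dirichletDom m → G.bddExt m f p = 0})

instance [FullAtoms m] : CompactSpace (G.Bdry m) := by
  refine isCompact_iff_compactSpace.mp (IsClosed.isCompact ?_)
  refine IsClosed.inter (s₁ := {p | p ∉ range (G.incl m)}) ?_ ?_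
  · rw [← isOpen_compl_iff]
    have h : {p | p ∉ range (G.incl m)}ᶜ = ⋃ x, {G.incl m x} := by
      ext p
      simp [eq_comm]
    rw [h]
    exact isOpen_iUnion fun x => G.isOpen_singleton_incl m lt_top x
  · change IsClosed {p | ∀ f : G.bddDom m, (f : X → ℝ) ∈ G.dirichletDom m → G.bddExt m f p = 0}
    simp only [ofPred_forall]
    exact isClosed_iInter fun f => isClosed_iInter fun _ =>
      isClosed_eq (G.continuous_bddExt m f) continuous_const

theorem add_mem_bddDom {f g : X → ℝ} (hf : f ∈ G.bddDom m) (hg : g ∈ G.bddDom m) :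
    f + g ∈ G.bddDom m := by
  obtain ⟨hf, K, hK⟩ := hf
  obtain ⟨hg, K', hK'⟩ := hg
  exact ⟨add_mem_neumannDom hf hg, K + K', fun x =>
    (abs_add_le _ _).trans (add_le_add (hK x) (hK' x))⟩

theorem smul_mem_bddDom {f : X → ℝ} (hf : f ∈ G.bddDom m) (a : ℝ) : a • f ∈ G.bddDom m := by
  obtain ⟨hf, K, hK⟩ := hf
  refine ⟨smul_mem_neumannDom hf a, |a| * K, fun x => ?_⟩
  rw [Pi.smul_apply, smul_eq_mul, abs_mul]
  exact mul_le_mul_of_nonneg_left (hK x) (abs_nonneg a)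

theorem trace₀_eq_of_tendsto (f : G.bddDom m) (z : G.Bdry m) {a : ℝ}
    (h : Tendsto (f : X → ℝ) (G.nhdsIn m z.1) (𝓝 a)) : G.trace₀ m f z = a :=
  tendsto_nhds_unique (tendsto_bddExt f z.1) h

theorem trace₀_add (f g : G.bddDom m) (z : G.Bdry m) :
    G.trace₀ m ⟨f + g, add_mem_bddDom f.2 g.2⟩ z = G.trace₀ m f z + G.trace₀ m g z :=
  trace₀_eq_of_tendsto _ z ((tendsto_bddExt f z.1).add (tendsto_bddExt g z.1))

theorem trace₀_smul (a : ℝ) (f : G.bddDom m) (z : G.Bdry m) :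
    G.trace₀ m ⟨a • f, smul_mem_bddDom f.2 a⟩ z = a * G.trace₀ m f z :=
  trace₀_eq_of_tendsto _ z ((tendsto_bddExt f z.1).const_mul a)

theorem trace₀_mul (f g : G.bddDom m) (z : G.Bdry m) :
    G.trace₀ m ⟨f * g, mul_mem_bddDom f.2 g.2⟩ z = G.trace₀ m f z * G.trace₀ m g z :=
  trace₀_eq_of_tendsto _ z ((tendsto_bddExt f z.1).mul (tendsto_bddExt g z.1))

variable [FullAtoms m]

theorem zero_mem_bddDom : (0 : X → ℝ) ∈ G.bddDom m := by
  refine ⟨?_, 0, by simp⟩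
  have := G.fn_mem m 0
  rwa [map_zero] at this

variable (G m) in
/-- The algebra of continuous functions on the boundary generated by the traces and the
constants. -/
def traceAlgebra : Subalgebra ℝ C(G.Bdry m, ℝ) where
  carrier := {F | ∃ (f : G.bddDom m) (c : ℝ), ∀ z, F z = G.trace₀ m f z + c}
  mul_mem' := by
    rintro F F' ⟨f, c, hf⟩ ⟨g, d, hg⟩
    refine ⟨⟨_, add_mem_bddDom (mul_mem_bddDom f.2 g.2) (add_mem_bddDom (smul_mem_bddDom f.2 d)
      (smul_mem_bddDom g.2 c))⟩, c * d, fun z => ?_⟩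
    rw [trace₀_add ⟨_, mul_mem_bddDom f.2 g.2⟩ ⟨_, add_mem_bddDom (smul_mem_bddDom f.2 d)
      (smul_mem_bddDom g.2 c)⟩, trace₀_mul, trace₀_add ⟨_, smul_mem_bddDom f.2 d⟩
      ⟨_, smul_mem_bddDom g.2 c⟩, trace₀_smul, trace₀_smul, ContinuousMap.mul_apply, hf, hg]
    ring
  add_mem' := by
    rintro F F' ⟨f, c, hf⟩ ⟨g, d, hg⟩
    refine ⟨⟨_, add_mem_bddDom f.2 g.2⟩, c + d, fun z => ?_⟩
    rw [trace₀_add, ContinuousMap.add_apply, hf, hg]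
    ring
  algebraMap_mem' r := ⟨⟨0, zero_mem_bddDom⟩, r, fun z => by
    rw [trace₀_eq_of_tendsto ⟨0, zero_mem_bddDom⟩ z (a := 0) tendsto_const_nhds]
    simp⟩

/-- Stone–Weierstrass: bounded traces separate points. Constants are adjoined since all traces may
vanish at one point. -/
theorem dense_traceAlgebra : Dense (G.traceAlgebra m : Set C(G.Bdry m, ℝ)) := by
  have h : (G.traceAlgebra m).topologicalClosure = ⊤ := by
    refine ContinuousMap.subalgebra_topologicalClosure_eq_top_of_separatesPoints _ fun z w hzw => ?_
    have : ∃ f : G.bddDom m, G.trace₀ m f z ≠ G.trace₀ m f w := by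
      by_contra! hcon
      exact hzw (Subtype.ext (G.bddExt_separates m hcon))
    obtain ⟨f, hf⟩ := this
    exact ⟨_, ⟨⟨G.trace₀ m f, continuous_trace₀ f⟩, ⟨f, 0, fun z => (add_zero _).symm⟩, rfl⟩, hf⟩
  intro F
  rw [← Subalgebra.topologicalClosure_coe, h]
  trivial

/-- A function in `L²(∂X, μ)` that is orthogonal to all bounded traces is zero. -/
theorem IsHarmonicMeasure.eq_zero_of_orthogonal {o : X} (hμ : G.IsHarmonicMeasure m o μ)
    (φ : Lp ℝ 2 μ) (h : ∀ f : G.bddDom m, ∫ z, φ z * G.trace₀ m f z ∂μ = 0) : φ = 0 := by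
  have := hμ.isFiniteMeasure
  have := hμ.regular
  have hdense : Dense (ContinuousMap.toLp 2 μ ℝ '' (G.traceAlgebra m : Set C(G.Bdry m, ℝ))) :=
    (ContinuousMap.toLp_denseRange ℝ μ ℝ (p := 2) (by simp)).dense_image
      (ContinuousMap.toLp 2 μ ℝ).continuous dense_traceAlgebra
  have hbdd : ∀ f : G.bddDom m, ∃ K : ℝ, ∀ z, |G.trace₀ m f z| ≤ K := fun f => by
    obtain ⟨K, hK⟩ := f.2.2
    exact ⟨K, fun z => le_of_tendsto' (tendsto_bddExt f z.1).abs hK⟩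
  have hmul : ∀ f : G.bddDom m, MemLp (fun z => φ z * G.trace₀ m f z) 2 μ := fun f => by
    obtain ⟨K, hK⟩ := hbdd f
    refine ((Lp.memLp φ).const_mul K).of_le ((Lp.memLp φ).1.mul
      (continuous_trace₀ f).measurable.aestronglyMeasurable) (Eventually.of_forall fun z => ?_)
    rw [norm_mul, norm_mul, mul_comm, Real.norm_eq_abs, Real.norm_eq_abs K]
    exact mul_le_mul_of_nonneg_right ((hK z).trans (le_abs_self K)) (norm_nonneg _)
  -- Multiplying φ by a trace f absorbs the adjoined constants: f(g + c) is the trace of fg + cf, so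
  -- φf is orthogonal to the whole dense algebra.
  have hzero : ∀ f : G.bddDom m, ∀ᵐ z ∂μ, φ z * G.trace₀ m f z = 0 := fun f => by
    have h0 : (hmul f).toLp _ = 0 := hdense.eq_zero_of_inner_right ℝ fun v hv => by
      obtain ⟨F, ⟨g, c, hg⟩, rfl⟩ := hv
      rw [L2.inner_def]
      have e : ∫ z, inner ℝ ((ContinuousMap.toLp 2 μ ℝ F : Lp ℝ 2 μ) z) ((hmul f).toLp _ z) ∂μ =
          ∫ z, (φ z * G.trace₀ m ⟨f * g, mul_mem_bddDom f.2 g.2⟩ z +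
            c * (φ z * G.trace₀ m f z)) ∂μ := by
        refine integral_congr_ae ?_
        filter_upwards [ContinuousMap.coeFn_toLp (p := 2) (𝕜 := ℝ) μ F, (hmul f).coeFn_toLp]
          with z h1 h2
        rw [h1, h2, hg, trace₀_mul]
        simp only [RCLike.inner_apply, conj_trivial]
        ring
      rw [e, integral_add ((hmul _).integrable (by norm_num))
        (((hmul f).integrable (by norm_num)).const_mul c), integral_const_mul, h, h]
      simp
    have h1 := (hmul f).coeFn_toLp
    rw [h0] at h1
    filter_upwards [h1, Lp.coeFn_zero ℝ 2 μ] with z h2 h3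
    rw [← h2, h3]
    rfl
  set N : Set (G.Bdry m) := {z | φ z ≠ 0} with hN
  set U : Set (G.Bdry m) := {z | ∃ f : G.bddDom m, G.trace₀ m f z ≠ 0} with hU
  have hUo : ∀ f : G.bddDom m, IsOpen {z | G.trace₀ m f z ≠ 0} := fun f =>
    isOpen_ne_fun (continuous_trace₀ f) continuous_const
  have hUopen : IsOpen U := by
    rw [hU, ofPred_exists]
    exact isOpen_iUnion hUo
  -- The open sets {f ≠ 0} covering U may be uncountably many; finite subcovers of compact sets, and
  -- then inner regularity, replace countable additivity.
  have hNK : ∀ K ⊆ U, IsCompact K → μ (N ∩ K) = 0 := fun K hKU hK => by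
    refine hK.induction_on (p := fun s => μ (N ∩ s) = 0) (by simp)
      (fun s t hst ht => measure_mono_null (inter_subset_inter_right _ hst) ht)
      (fun s t hs ht => by
        rw [inter_union_distrib_left]
        exact measure_union_null hs ht)
      (fun z hz => ?_)
    obtain ⟨f, hf⟩ := hKU hz
    refine ⟨_, mem_nhdsWithin_of_mem_nhds ((hUo f).mem_nhds hf), measure_mono_null ?_
      (ae_iff.1 (hzero f))⟩
    rintro w ⟨hw, hw'⟩
    exact mul_ne_zero hw hw'
  have hNU : μ (N ∩ U) = 0 := by
    refine le_antisymm (le_of_forall_gt_imp_ge_of_dense fun ε hε => ?_) zero_le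
    obtain ⟨K, hKU, hK, hlt⟩ := hUopen.measurableSet.exists_isCompact_sdiff_lt
      (measure_ne_top μ U) hε.ne'
    calc μ (N ∩ U) ≤ μ (N ∩ K ∪ U \ K) := measure_mono fun z hz => by
          by_cases hzK : z ∈ K
          · exact Or.inl ⟨hz.1, hzK⟩
          · exact Or.inr ⟨hz.2, hzK⟩
      _ ≤ μ (N ∩ K) + μ (U \ K) := measure_union_le _ _
      _ ≤ ε := by rw [hNK K hKU hK, zero_add]; exact hlt.le
  -- All traces vanish off U and they separate points, so Uᶜ has at most one point. It is empty if 1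
  -- ∈ D(Q^(N)); otherwise harmonic measure does not charge it.
  have hUc : μ Uᶜ = 0 := by
    by_cases h1 : (fun _ => (1 : ℝ)) ∈ G.neumannDom m
    · have : Uᶜ = ∅ := by
        rw [compl_empty_iff, eq_univ_iff_forall]
        intro z
        refine ⟨⟨_, h1, 1, by simp⟩, ?_⟩
        rw [trace₀_eq_of_tendsto _ z (a := 1) tendsto_const_nhds]
        exact one_ne_zero
      rw [this, measure_empty]
    · have hz0 : ∀ z ∈ Uᶜ, ∀ f : G.bddDom m, G.trace₀ m f z = 0 := fun z hz f => by
        by_contra hne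
        exact hz ⟨f, hne⟩
      rcases Uᶜ.eq_empty_or_nonempty with he | ⟨z, hz⟩
      · rw [he, measure_empty]
      · refine measure_mono_null (fun w hw => ?_) (hμ.infty h1 z (hz0 z hz))
        exact Subtype.ext (G.bddExt_separates m fun f => (hz0 w hw f).trans (hz0 z hz f).symm)
  refine Lp.eq_zero_iff_ae_eq_zero.2 (ae_iff.2 (measure_mono_null (fun z hz => ?_)
    (measure_union_null hNU hUc)))
  by_cases hzU : z ∈ U
  · exact Or.inl ⟨hz, hzU⟩
  · exact Or.inr hzU

theorem IsHarmonicMeasure.normalDerivKer_eq {o : X} (hμ : G.IsHarmonicMeasure m o μ) :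
    {f | f ∈ G.neumannDom m ∧ MemLp (G.lap m f) 2 m ∧
      ∀ g ∈ G.neumannDom m, G.normalFunctional m f g = 0} = G.normalDerivKer m μ := by
  have hzero : ∀ g : X → ℝ, ∫ z, (0 : Lp ℝ 2 μ) z * (G.trace m g z).toReal ∂μ = 0 := fun g => by
    refine integral_eq_zero_of_ae ?_
    filter_upwards [Lp.coeFn_zero ℝ 2 μ] with z hz
    rw [hz]
    simp
  ext f
  constructor
  · rintro ⟨hf, hm, h⟩
    have hd : f ∈ G.normalDerivDom m μ := ⟨hf, hm, 0, fun g hg => by rw [hzero, h g hg]⟩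
    refine ⟨hd, ?_⟩
    rw [normalDeriv, dif_pos hd]
    -- The density in `normalDeriv` is a chosen one; pairing it with bounded traces alone shows that
    -- it is zero.
    refine hμ.eq_zero_of_orthogonal _ fun g => ?_
    rw [← h g g.2.1, ← hd.2.2.choose_spec g g.2.1]
    simp only [trace_eq_trace₀, EReal.toReal_coe]
  · rintro ⟨hd, h0⟩
    refine ⟨hd.1, hd.2.1, fun g hg => ?_⟩
    rw [normalDeriv, dif_pos hd] at h0
    rw [← hd.2.2.choose_spec g hg, h0, hzero]

end WGraph

end

/-- The descriptions of L^(D) and L^(N) by trace and normal functional involve no harmonic measure,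
so they stand outside the quantifier over μ. -/
theorem mainTheorem4 {X : Type*} [Countable X] [MeasurableSpace X] [DiscreteMeasurableSpace X]
    (m : Measure X) (hm : ∀ x, 0 < m {x} ∧ m {x} < ∞) (G : WGraph X) :
    (∀ (o : X) (μ : Measure (G.Bdry m)), G.IsHarmonicMeasure m o μ →
      (∀ β : G.Bdry m → ℝ≥0∞, Measurable β →
        (G.robinForm m μ β).IsDirichletForm ∧
          ∃ L : Lp ℝ 2 m →ₗ.[ℝ] Lp ℝ 2 m, HForm.IsOperatorOf L (G.robinForm m μ β) ∧
            G.IsLapRestriction m L (G.robinDom m μ β)) ∧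
      (G.Connected → (G.dirichletForm m).Same (G.robinForm m μ (fun _ => ∞))) ∧
      (G.neumannForm m).Same (G.robinForm m μ (fun _ => 0)) ∧
      {f | f ∈ G.neumannDom m ∧ MemLp (G.lap m f) 2 m ∧
        ∀ g ∈ G.neumannDom m, G.normalFunctional m f g = 0} = G.normalDerivKer m μ) ∧
    (∃ L : Lp ℝ 2 m →ₗ.[ℝ] Lp ℝ 2 m, HForm.IsOperatorOf L (G.dirichletForm m) ∧
      G.IsLapRestriction m L {f | f ∈ G.neumannDom m ∧ MemLp (G.lap m f) 2 m ∧
        ∀ z, G.trace m f z = 0}) ∧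
    (∃ L : Lp ℝ 2 m →ₗ.[ℝ] Lp ℝ 2 m, HForm.IsOperatorOf L (G.neumannForm m) ∧
      G.IsLapRestriction m L {f | f ∈ G.neumannDom m ∧ MemLp (G.lap m f) 2 m ∧
        ∀ g ∈ G.neumannDom m, G.normalFunctional m f g = 0}) := by
  have : FullAtoms m := ⟨fun x => (hm x).1, fun x => (hm x).2⟩
  exact ⟨fun o μ hμ => ⟨fun β hβ => ⟨hμ.robinForm_isDirichletForm hβ, hμ.exists_robinLaplacian hβ⟩,
    hμ.dirichletForm_same_robinForm, WGraph.neumannForm_same_robinForm, hμ.normalDerivKer_eq⟩,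
    WGraph.exists_dirichletLaplacian, WGraph.exists_neumannLaplacian⟩
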